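/- Let $p\ge 3$ be an integer, $\beta\ge 0$, $h\in\mathbb R$. The $p$-tensor Curie-Weiss model on $\{-1,1\}^N$ is the probability law $$\mathbb P_{\beta,h,p}(x)=\frac{1}{2^N Z_N(\beta,h,p)}\exp\Big\{\frac{\beta}{N^{p-1}}\sum_{1\le i_1,\dots,i_p\le N}x_{i_1}\cdots x_{i_p}+h\sum_{i=1}^N x_i\Big\},$$ where $Z_N(\beta,h,p)$ is the normalizing constant. For $x\in[-1,1]$ put $$H(x)=H_{\beta,h,p}(x)=\beta x^p+hx-\tfrac12\{(1+x)\log(1+x)+(1-x)\log(1-x)\}\qquad(0\log 0=0),$$ and let $\tilde\beta_p=\sup\{\beta'\ge 0:\sup_{x\in[-1,1]}H_{\beta',0,p}(x)=0\}$. Suppose that $(\beta,h)$ is $p$-critical, that is, $H$ has more than one global maximizer on $[-1,1]$. Let $X\sim\mathbb P_{\beta,h,p}$ on $\{-1,1\}^N$, and let $\hat h_N=\hat h_N(X)$ be the maximum likelihood estimator of $h$ for known $\beta$, i.e. a maximizer over $h'\in\mathbb R$ of $h'\mapsto\mathbb P_{\beta,h',p}(X)$ whenever one exists; where none exists, $\hat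 h_N$ may take any real value. For $v>0$ let $N^{+}(0,v)$ and $N^{-}(0,v)$ be the laws of $|Z|$ and of $-|Z|$ for $Z\sim N(0,v)$, and let $\delta_0$ be the point mass at $0$. Then $H$ has $K\in\{2,3\}$ global maximizers $m_1<\dots<m_K$; all of them lie in $(-1,1)$ and satisfy $H''(m_k)<0$. With $$p_k=\frac{[(m_k^2-1)H''(m_k)]^{-1/2}}{\sum_{i=1}^K[(m_i^2-1)H''(m_i)]^{-1/2}},\qquad 1\le k\le K,$$ the following hold, with convergence in distribution as $N\to\infty$. (1) If $p$ is odd, then $K=2$, $m_1\ne -m_2$, and $$\sqrt N(\hat h_N-h)\xrightarrow{D}\tfrac{p_1}{2}N^-(0,-H''(m_1))+\tfrac{1-p_1}{2}N^+(0,-H''(m_2))+\tfrac12\delta_0.$$ (2) If $p$ is even, then: - if $h\neq 0$, then $K=2$, $m_1\ne -m_2$, and $$\sqrt N(\hat h_N-h)\xrightarrow{D}\tfrac{p_1}{2}N^-(0,-H''(m_1))+\tfrac{1-p_1}{2}N^+(0,-H''(m_2))+\tfrac12\delta_0;$$ - if $h=0$ and $\beta>\tilde\beta_p$, then the maximizers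 are exactly $-m_*$ and $m_*$ for some $m_*>0$, and $$\sqrt N\,\hat h_N\xrightarrow{D}\tfrac12N(0,-H''(m_*))+\tfrac12\delta_0;$$ - if $h=0$ and $\beta=\tilde\beta_p$, then the maximizers are exactly $m_1=-m_*$, $m_2=0$, $m_3=m_*$ for some $m_*>0$, and $$\sqrt N\,\hat h_N\xrightarrow{D}p_1N(0,-H''(m_1))+(1-p_1)\delta_0.$$ -/

import Mathlib

open MeasureTheory ProbabilityTheory Filter Set
open scoped NNReal ENNReal Topology

noncomputable section

namespace CurieWeiss

/-- The configuration space `{-1, 1}^N`; it is finite and carries the discrete `σ`-algebra. -/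
def SpinConfig (N : ℕ) : Type := Fin N → ℤˣ

instance (N : ℕ) : Fintype (SpinConfig N) := inferInstanceAs (Fintype (Fin N → ℤˣ))

instance (N : ℕ) : Nonempty (SpinConfig N) := inferInstanceAs (Nonempty (Fin N → ℤˣ))

instance (N : ℕ) : MeasurableSpace (SpinConfig N) := ⊤

instance (N : ℕ) : DiscreteMeasurableSpace (SpinConfig N) := ⟨fun _ => trivial⟩

/-- The `i`-th spin `X_i ∈ {-1, 1}`, as a real number. -/
def spin {N : ℕ} (x : SpinConfig N) (i : Fin N) : ℝ := ((x i : ℤ) : ℝ)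

/-- The exponent
`(β / N^(p-1)) * ∑_{i_1, ..., i_p} X_{i_1} ⋯ X_{i_p} + h * ∑_i X_i`
of the `p`-tensor Curie-Weiss model. -/
def exponent (p : ℕ) (β h : ℝ) {N : ℕ} (x : SpinConfig N) : ℝ :=
  β / (N : ℝ) ^ (p - 1) * ∑ i : Fin p → Fin N, ∏ j : Fin p, spin x (i j)
    + h * ∑ i : Fin N, spin x i

/-- The partition function `Z_N(β, h, p)`. -/
def partitionFunction (p : ℕ) (β h : ℝ) (N : ℕ) : ℝ :=
  1 / 2 ^ N * ∑ x : SpinConfig N, Real.exp (exponent p β h x)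

/-- The probability mass `ℙ_{β,h,p}(x)` of the configuration `x`; as a function of the
parameters it is the likelihood. -/
def likelihood (p : ℕ) (β h : ℝ) {N : ℕ} (x : SpinConfig N) : ℝ :=
  Real.exp (exponent p β h x) / (2 ^ N * partitionFunction p β h N)

/-- The law `ℙ_{β,h,p}` of the `p`-tensor Curie-Weiss model on `{-1, 1}^N`. -/
def law (p : ℕ) (β h : ℝ) (N : ℕ) : Measure (SpinConfig N) :=
  ∑ x : SpinConfig N, ENNReal.ofReal (likelihood p β h x) • Measure.dirac x

theorem sum_likelihood (p : ℕ) (β h : ℝ) (N : ℕ) :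
    ∑ x : SpinConfig N, likelihood p β h x = 1 := by
  have hpos : 0 < ∑ x : SpinConfig N, Real.exp (exponent p β h x) :=
    Finset.sum_pos (fun _ _ => Real.exp_pos _) Finset.univ_nonempty
  have h2 : (2 : ℝ) ^ N * partitionFunction p β h N
      = ∑ x : SpinConfig N, Real.exp (exponent p β h x) := by
    unfold partitionFunction
    field_simp
  simp only [likelihood, h2]
  rw [← Finset.sum_div, div_self hpos.ne']

theorem likelihood_nonneg (p : ℕ) (β h : ℝ) {N : ℕ} (x : SpinConfig N) :
    0 ≤ likelihood p β h x := by
  unfold likelihood partitionFunction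
  positivity

instance isProbabilityMeasure_law (p : ℕ) (β h : ℝ) (N : ℕ) :
    IsProbabilityMeasure (law p β h N) := by
  constructor
  simp only [law, Measure.coe_finsetSum, Finset.sum_apply, Measure.smul_apply, measure_univ,
    smul_eq_mul, mul_one]
  rw [← ENNReal.ofReal_sum_of_nonneg (fun x _ => likelihood_nonneg p β h x), sum_likelihood,
    ENNReal.ofReal_one]

/-- `hhat` is a maximum likelihood estimator of `h` for known `β`, from one sample of size `N`:
`hhat x` maximizes `h' ↦ ℙ_{β,h',p}(x)` over `ℝ` whenever a maximizer exists. (None exists exactly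
if `N ≥ 1` and all spins are equal; there the value of `hhat` is unrestricted.) -/
def IsMLE (p : ℕ) (β : ℝ) {N : ℕ} (hhat : SpinConfig N → ℝ) : Prop :=
  ∀ x : SpinConfig N, (∃ h₀ : ℝ, ∀ h' : ℝ, likelihood p β h' x ≤ likelihood p β h₀ x) →
    ∀ h' : ℝ, likelihood p β h' x ≤ likelihood p β (hhat x) x

/-- The binary entropy function `I` on `[-1, 1]` (with `0 log 0 = 0`). -/
def entropyI (x : ℝ) : ℝ :=
  1 / 2 * ((1 + x) * Real.log (1 + x) + (1 - x) * Real.log (1 - x))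

/-- `H_{β,h,p}(x) = β x^p + h x - I(x)`, to be considered on `[-1, 1]`. -/
def H (p : ℕ) (β h : ℝ) (x : ℝ) : ℝ := β * x ^ p + h * x - entropyI x

/-- The second derivative `H''`. -/
def H'' (p : ℕ) (β h : ℝ) (x : ℝ) : ℝ := iteratedDeriv 2 (H p β h) x

/-- The set of global maximizers of `H_{β,h,p}` on `[-1, 1]`. -/
def maximizers (p : ℕ) (β h : ℝ) : Set ℝ :=
  {m | m ∈ Icc (-1 : ℝ) 1 ∧ ∀ x ∈ Icc (-1 : ℝ) 1, H p β h x ≤ H p β h m}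

/-- `(β, h)` is `p`-critical: `β ≥ 0` and `H_{β,h,p}` has more than one global maximizer. -/
def IsCritical (p : ℕ) (β h : ℝ) : Prop := 0 ≤ β ∧ (maximizers p β h).Nontrivial

/-- The threshold `sup {β ≥ 0 : sup_{x ∈ [-1,1]} H_{β,0,p}(x) = 0}`. -/
def betaTilde (p : ℕ) : ℝ :=
  sSup {β : ℝ | 0 ≤ β ∧ sSup (H p β 0 '' Icc (-1 : ℝ) 1) = 0}

/-- The mixture weight
`[(m^2 - 1) H''(m)]^(-1/2) / ∑_i [(m_i^2 - 1) H''(m_i)]^(-1/2)` of a maximizer `m`, where the sum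
is over all the (finitely many) global maximizers `m_i` of `H`. -/
def weight (p : ℕ) (β h : ℝ) (m : ℝ) : ℝ :=
  ((m ^ 2 - 1) * H'' p β h m) ^ (-(1 / 2) : ℝ) /
    ∑ᶠ i ∈ maximizers p β h, ((i ^ 2 - 1) * H'' p β h i) ^ (-(1 / 2) : ℝ)

/-- The normal distribution `N(0, v)` with variance `v > 0`. -/
def normal (v : ℝ) : Measure ℝ := gaussianReal 0 v.toNNReal

/-- The positive half-normal distribution `N⁺(0, v)`: the law of `|Z|` for `Z ∼ N(0, v)`. -/
def halfNormalPos (v : ℝ) : Measure ℝ := (normal v).map fun z => |z|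

/-- The negative half-normal distribution `N⁻(0, v)`: the law of `-|Z|` for `Z ∼ N(0, v)`. -/
def halfNormalNeg (v : ℝ) : Measure ℝ := (normal v).map fun z => -|z|

/-- `X_N →ᴰ ν` as `N → ∞`, where `X_N` is a random variable on the probability space
`(Ω_N, P_N)` and `ν` is a probability measure on `ℝ`. -/
def ConvergesInLaw {Ω : ℕ → Type} [∀ N, MeasurableSpace (Ω N)] (X : ∀ N, Ω N → ℝ)
    (P : ∀ N, Measure (Ω N)) [∀ N, IsProbabilityMeasure (P N)] (ν : Measure ℝ) : Prop :=
  ∃ _ : IsProbabilityMeasure ν, TendstoInDistribution X atTop (id : ℝ → ℝ) P ν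

end CurieWeiss

end

noncomputable section

namespace CurieWeiss

/-! ### Calculus of `H` -/

/-! The estimator is controlled through the magnetization. As a function of the field, the inverse
likelihood of a configuration is a sum of exponentials of affine functions, hence convex. At the
field `h + s/√N` it is, up to a factor free of `s`, the quantity `exp(-s√N(mag - e))` times the
moment generating function at `s` of `√N(mag - e)`, for any centering `e` (`invLikelihood_eq`). By
convexity the event `√N(ĥ - h) ≤ t` is therefore squeezed between events saying that `√N(mag - e)`
is at most a chord slope of the cumulant generating function, the chord joining `t` to a point on
one side or the other (`IsMLE.le_chordSlope`, `IsMLE.chordSlope_le`).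

The law of `mag` comes from Laplace's method: Stirling's formula gives the mass of each site as a
smooth factor times `exp(N H)`, and under the scaling `√N` every maximizer `m` carries asymptotic
probability `p_m` and a Gaussian of variance `-1/H''(m)` (`tendsto_scaledMass`,
`IsPeakSet.tendsto_expect`). A positive tilt `s` favours the largest maximizer by factors
exponential in `√N`, and a negative tilt the smallest. Centered at that extremal maximizer `e`, the
cumulant generating function tends to `log p_e + s²/(2(-H''(e)))`, and the chord slopes tend to
`t/(-H''(e))` once the chord shrinks. Thus negative `t` sees only the smallest maximizer, with limit
`p_a Φ_a(t)`, while positive `t` sees only the largest, `b`, with limit `1 - p_b + p_b Φ_b(t)`,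
where `Φ` is the distribution function of `N(0, -H'')` (`IsPeakSet.tendsto_law_real_mle`). The jump
left at `0` is the point mass in the limit.

The classification of the maximizers is Rolle's theorem: `H''` has at most two zeros on `[0, 1)`,
and for odd `p` at most two on `(-1, 1)` (`curv_zeros_pos`). This bounds the number of critical
points and forces the maximizers to be nondegenerate. For even `p`, reflection brings everything to
`[0, 1)`. -/

/-- The first derivative of `H` on `(-1, 1)`. -/
def slope (p : ℕ) (β h x : ℝ) : ℝ :=
  β * (p * x ^ (p - 1)) + h - 1 / 2 * (Real.log (1 + x) - Real.log (1 - x))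

/-- The second derivative of `H` on `(-1, 1)`. -/
def curv (p : ℕ) (β x : ℝ) : ℝ :=
  β * (p * ((p - 1 : ℕ) * x ^ (p - 2))) - 1 / (1 - x ^ 2)

theorem continuous_entropyI : Continuous entropyI := by
  unfold entropyI
  have h1 : Continuous fun x : ℝ => (1 + x) * Real.log (1 + x) :=
    Real.continuous_mul_log.comp (by fun_prop : Continuous fun x : ℝ => 1 + x)
  have h2 : Continuous fun x : ℝ => (1 - x) * Real.log (1 - x) :=
    Real.continuous_mul_log.comp (by fun_prop : Continuous fun x : ℝ => 1 - x)
  exact continuous_const.mul (h1.add h2)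

theorem continuous_H (p : ℕ) (β h : ℝ) : Continuous (H p β h) := by
  unfold H
  exact (by fun_prop : Continuous fun x : ℝ => β * x ^ p + h * x).sub continuous_entropyI

theorem entropyI_neg (x : ℝ) : entropyI (-x) = entropyI x := by
  simp only [entropyI, sub_neg_eq_add, ← sub_eq_add_neg]
  ring

theorem H_neg (p : ℕ) (β h x : ℝ) : H p β h (-x) = H p ((-1) ^ p * β) (-h) x := by
  simp only [H, entropyI_neg]
  rw [neg_pow x p]
  ring

theorem hasDerivAt_entropyI {x : ℝ} (hx : x ∈ Ioo (-1 : ℝ) 1) :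
    HasDerivAt entropyI (1 / 2 * (Real.log (1 + x) - Real.log (1 - x))) x := by
  have a : (1 + x) ≠ 0 := by linarith [hx.1]
  have b : (1 - x) ≠ 0 := by linarith [hx.2]
  have h1 : HasDerivAt (fun x : ℝ => 1 + x) 1 x := (hasDerivAt_id x).const_add 1
  have h2 : HasDerivAt (fun x : ℝ => 1 - x) (-1) x := (hasDerivAt_id x).const_sub 1
  have := ((h1.mul (h1.log a)).add (h2.mul (h2.log b))).const_mul (1 / 2)
  refine HasDerivAt.congr_deriv (f := entropyI) this ?_
  field_simp
  ring

theorem hasDerivAt_H (p : ℕ) (β h : ℝ) {x : ℝ} (hx : x ∈ Ioo (-1 : ℝ) 1) :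
    HasDerivAt (H p β h) (slope p β h x) x := by
  have := (((hasDerivAt_pow p x).const_mul β).add ((hasDerivAt_id x).const_mul h)).sub
    (hasDerivAt_entropyI hx)
  refine HasDerivAt.congr_deriv (f := H p β h) this ?_
  simp only [slope]
  ring

theorem hasDerivAt_slope (p : ℕ) (β h : ℝ) {x : ℝ} (hx : x ∈ Ioo (-1 : ℝ) 1) :
    HasDerivAt (slope p β h) (curv p β x) x := by
  have a : (1 + x) ≠ 0 := by linarith [hx.1]
  have b : (1 - x) ≠ 0 := by linarith [hx.2]
  have h1 : HasDerivAt (fun x : ℝ => 1 + x) 1 x := (hasDerivAt_id x).const_add 1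
  have h2 : HasDerivAt (fun x : ℝ => 1 - x) (-1) x := (hasDerivAt_id x).const_sub 1
  have := ((((hasDerivAt_pow (p - 1) x).const_mul (p : ℝ)).const_mul β).add_const h).sub
    (((h1.log a).sub (h2.log b)).const_mul (1 / 2))
  refine HasDerivAt.congr_deriv (f := slope p β h) this ?_
  unfold curv
  have : 1 - x ^ 2 = (1 + x) * (1 - x) := by ring
  rw [this, Nat.sub_sub]
  field_simp
  ring

theorem H''_eq_curv (p : ℕ) (β h : ℝ) {x : ℝ} (hx : x ∈ Ioo (-1 : ℝ) 1) :
    H'' p β h x = curv p β x := by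
  unfold H''
  rw [iteratedDeriv_succ, iteratedDeriv_one]
  have : deriv (H p β h) =ᶠ[𝓝 x] slope p β h := by
    filter_upwards [isOpen_Ioo.mem_nhds hx] with y hy
    exact (hasDerivAt_H p β h hy).deriv
  rw [this.deriv_eq]
  exact (hasDerivAt_slope p β h hx).deriv

/-- Second-order Taylor expansion of `H` at an interior critical point. -/
theorem abs_H_sub_quadratic_le {p : ℕ} {β h m : ℝ} (hm : m ∈ Ioo (-1 : ℝ) 1)
    (hs : slope p β h m = 0) {ε : ℝ} (hε : 0 < ε) :
    ∃ δ > 0, ∀ u, |u| < δ →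
      |H p β h (m + u) - H p β h m - curv p β m / 2 * u ^ 2| ≤ ε * u ^ 2 := by
  have hd := (hasDerivAt_slope p β h hm).isLittleO
  rw [Asymptotics.isLittleO_iff] at hd
  have hd' := (hd hε).and (isOpen_Ioo.mem_nhds hm)
  obtain ⟨δ, hδ, hball⟩ := Metric.eventually_nhds_iff.1 hd'
  refine ⟨δ, hδ, fun u hu => ?_⟩
  -- Mean value inequality for `H` minus its quadratic part: the derivative of the difference is at
  -- most `ε|u|` on the segment, because the slope vanishes at `m` and is differentiable there.
  have key := Convex.norm_image_sub_le_of_norm_hasDerivWithin_le (𝕜 := ℝ)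
    (f := fun y => H p β h y - curv p β m / 2 * (y - m) ^ 2)
    (f' := fun y => slope p β h y - curv p β m * (y - m)) (s := uIcc m (m + u))
    (x := m) (y := m + u) (C := ε * |u|) ?_ ?_ (convex_uIcc _ _) left_mem_uIcc right_mem_uIcc
  · simp only [add_sub_cancel_left, sub_self, Real.norm_eq_abs] at key
    calc _ = |H p β h (m + u) - curv p β m / 2 * u ^ 2
            - (H p β h m - curv p β m / 2 * 0 ^ 2)| := by congr 1; ring
      _ ≤ ε * |u| * |u| := key
      _ = ε * u ^ 2 := by rw [mul_assoc, abs_mul_abs_self]; ring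
  · intro y hy
    have hyd : |y - m| ≤ |u| := by simpa using abs_sub_left_of_mem_uIcc hy
    have hb := hball (y := y) (by rw [Real.dist_eq]; linarith)
    apply HasDerivAt.hasDerivWithinAt
    have h2 : HasDerivAt (fun y : ℝ => (y - m) ^ 2) (2 * (y - m)) y := by
      refine HasDerivAt.congr_deriv (((hasDerivAt_id y).sub_const m).pow 2) ?_
      simp
    refine HasDerivAt.congr_deriv ((hasDerivAt_H p β h hb.2).sub
      (h2.const_mul (curv p β m / 2))) ?_
    ring
  · intro y hy
    have hyd : |y - m| ≤ |u| := by simpa using abs_sub_left_of_mem_uIcc hy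
    have hb := (hball (y := y) (by rw [Real.dist_eq]; linarith)).1
    rw [hs] at hb
    simp only [smul_eq_mul, sub_zero, Real.norm_eq_abs] at hb ⊢
    rw [mul_comm (curv p β m)]
    exact hb.trans (mul_le_mul_of_nonneg_left hyd hε.le)

/-! ### Maximizers are interior critical points -/

/-- The derivative of the entropy blows up at `1`, so `H` strictly decreases just before it. The
constant `C` exceeds the polynomial part of the slope by `1`, and beyond `1 - exp(-2C)` the
logarithm contributes less than `-C`. -/
theorem exists_H_one_lt (p : ℕ) (β h : ℝ) : ∃ x ∈ Icc (-1 : ℝ) 1, H p β h 1 < H p β h x := by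
  set C := |β| * p + |h| + 1 with hC
  have hCpos : 0 < C := by positivity
  have hexp : Real.exp (-(2 * C)) < 1 := Real.exp_lt_one_iff.2 (by linarith)
  have hexp0 := Real.exp_pos (-(2 * C))
  refine ⟨1 - Real.exp (-(2 * C)), ⟨by linarith, by linarith⟩, ?_⟩
  have hanti : StrictAntiOn (H p β h) (Icc (1 - Real.exp (-(2 * C))) 1) := by
    refine strictAntiOn_of_deriv_neg (convex_Icc _ _) (continuous_H p β h).continuousOn ?_
    intro x hx
    rw [interior_Icc] at hx
    have hx0 : 0 < x := by linarith [hx.1]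
    rw [(hasDerivAt_H p β h ⟨by linarith, hx.2⟩).deriv, slope]
    have h1 : 0 ≤ Real.log (1 + x) := Real.log_nonneg (by linarith)
    have h2 : Real.log (1 - x) < -(2 * C) := by
      rw [Real.log_lt_iff_lt_exp (by linarith [hx.2])]; linarith [hx.1]
    have h3 : β * (p * x ^ (p - 1)) ≤ |β| * p := by
      have : x ^ (p - 1) ≤ 1 := pow_le_one₀ hx0.le hx.2.le
      have h4 : (p : ℝ) * x ^ (p - 1) ≤ p := mul_le_of_le_one_right (by positivity) this
      exact (mul_le_mul_of_nonneg_right (le_abs_self β) (by positivity)).trans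
        (mul_le_mul_of_nonneg_left h4 (abs_nonneg β))
    have h5 := le_abs_self h
    linarith
  exact hanti ⟨le_refl _, by linarith⟩ ⟨by linarith, le_refl _⟩ (by linarith)

/-- The endpoint `-1` is reflected to `1`, which replaces `β` by `(-1)^p β`; this is why
`exists_H_one_lt` allows either sign. -/
theorem mem_Ioo_of_mem_maximizers {p : ℕ} {β h m : ℝ} (hm : m ∈ maximizers p β h) :
    m ∈ Ioo (-1 : ℝ) 1 := by
  refine ⟨lt_of_le_of_ne hm.1.1 ?_, lt_of_le_of_ne hm.1.2 ?_⟩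
  · rintro rfl
    obtain ⟨x, hx, hlt⟩ := exists_H_one_lt p ((-1) ^ p * β) (-h)
    have := hm.2 (-x) ⟨by linarith [hx.2], by linarith [hx.1]⟩
    rw [H_neg, H_neg] at this
    linarith
  · rintro rfl
    obtain ⟨x, hx, hlt⟩ := exists_H_one_lt p β h
    linarith [hm.2 x hx]

theorem slope_eq_zero_of_mem_maximizers {p : ℕ} {β h m : ℝ} (hm : m ∈ maximizers p β h) :
    slope p β h m = 0 := by
  have hi := mem_Ioo_of_mem_maximizers hm
  refine IsLocalMax.hasDerivAt_eq_zero (f := H p β h) ?_ (hasDerivAt_H p β h hi)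
  filter_upwards [Icc_mem_nhds hi.1 hi.2] with x hx using hm.2 x hx

theorem curv_nonpos_of_mem_maximizers {p : ℕ} {β h m : ℝ} (hm : m ∈ maximizers p β h) :
    curv p β m ≤ 0 := by
  by_contra! hc
  have hi := mem_Ioo_of_mem_maximizers hm
  obtain ⟨δ, hδ, hq⟩ := abs_H_sub_quadratic_le hi (slope_eq_zero_of_mem_maximizers hm)
    (ε := curv p β m / 4) (by linarith)
  obtain ⟨u, hu0, hu⟩ : ∃ u, 0 < u ∧ u < min δ (1 - m) :=
    exists_between (lt_min hδ (by linarith [hi.2]))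
  have h1 := hq u (by rw [abs_of_pos hu0]; exact hu.trans_le (min_le_left _ _))
  have h2 := hm.2 (m + u) ⟨by linarith [hi.1], by linarith [hu.trans_le (min_le_right _ _)]⟩
  have h3 := (abs_le.1 h1).1
  have h4 : 0 < curv p β m * u ^ 2 := by positivity
  linarith

theorem H_eq_of_mem_maximizers {p : ℕ} {β h m m' : ℝ} (hm : m ∈ maximizers p β h)
    (hm' : m' ∈ maximizers p β h) : H p β h m = H p β h m' :=
  le_antisymm (hm'.2 m hm.1) (hm.2 m' hm'.1)

theorem nonempty_maximizers (p : ℕ) (β h : ℝ) : (maximizers p β h).Nonempty := by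
  obtain ⟨m, hm, hmax⟩ := isCompact_Icc.exists_isMaxOn (nonempty_Icc.2 (by norm_num : (-1 : ℝ) ≤ 1))
    (continuous_H p β h).continuousOn
  exact ⟨m, hm, fun x hx => hmax hx⟩

/-! ### Counting critical points by Rolle's theorem -/

theorem exists_slope_eq_zero {p : ℕ} {β h a b : ℝ} (ha : a ∈ Ioo (-1 : ℝ) 1)
    (hb : b ∈ Ioo (-1 : ℝ) 1) (hab : a < b) (hH : H p β h a = H p β h b) :
    ∃ c ∈ Ioo a b, slope p β h c = 0 :=
  exists_hasDerivAt_eq_zero hab (continuous_H p β h).continuousOn hH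
    fun _ hx => hasDerivAt_H p β h ⟨ha.1.trans hx.1, hx.2.trans hb.2⟩

theorem exists_curv_eq_zero {p : ℕ} {β h a b : ℝ} (ha : a ∈ Ioo (-1 : ℝ) 1)
    (hb : b ∈ Ioo (-1 : ℝ) 1) (hab : a < b) (hsa : slope p β h a = 0)
    (hsb : slope p β h b = 0) : ∃ c ∈ Ioo a b, curv p β c = 0 :=
  exists_hasDerivAt_eq_zero hab
    (fun _ hx => (hasDerivAt_slope p β h ⟨ha.1.trans_le hx.1, hx.2.trans_lt hb.2⟩).continuousAt.continuousWithinAt)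
    (hsa.trans hsb.symm)
    fun _ hx => hasDerivAt_slope p β h ⟨ha.1.trans hx.1, hx.2.trans hb.2⟩

/-- On `(0, 1)` a zero of `H''` solves `βp(p-1) w^(p-2) (1 - w²) = 1`. The left side has a single
positive critical point, given by `w² = (p-2)/p`, whereas three solutions would produce two by
Rolle. -/
theorem curv_zeros_pos {p : ℕ} (hp : 3 ≤ p) {β x y z : ℝ} (hx : 0 < x) (hxy : x < y)
    (hyz : y < z) (hz : z < 1) (cx : curv p β x = 0) (cy : curv p β y = 0)
    (cz : curv p β z = 0) : False := by
  obtain ⟨n, rfl⟩ : ∃ n, p = n + 3 := ⟨p - 3, by omega⟩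
  set c : ℝ := β * ((n + 3 : ℕ) * (n + 2 : ℕ)) with hc
  have hq : ∀ w, 0 < w → w < 1 → curv (n + 3) β w = 0 → c * (w ^ (n + 1) * (1 - w ^ 2)) = 1 := by
    intro w hw0 hw1 h0
    have h1 : 1 - w ^ 2 ≠ 0 := by nlinarith
    simp only [curv, show n + 3 - 1 = n + 2 by omega,
      show n + 3 - 2 = n + 1 by omega] at h0
    rw [hc]
    field_simp at h0 ⊢
    linarith
  have hd : ∀ w : ℝ, HasDerivAt (fun w : ℝ => c * (w ^ (n + 1) * (1 - w ^ 2)))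
      (c * w ^ n * ((n + 1) - (n + 3) * w ^ 2)) w := by
    intro w
    have h1 := ((hasDerivAt_pow (n + 1) w).mul ((hasDerivAt_pow 2 w).const_sub 1)).const_mul c
    refine HasDerivAt.congr_deriv h1 ?_
    push_cast [Nat.add_sub_cancel]
    ring
  have hcont : Continuous (fun w : ℝ => c * (w ^ (n + 1) * (1 - w ^ 2))) := by fun_prop
  have ex := hq x hx (by linarith) cx
  have ey := hq y (by linarith) (by linarith) cy
  have ez := hq z (by linarith) hz cz
  obtain ⟨a, ha, ha0⟩ := exists_hasDerivAt_eq_zero hxy hcont.continuousOn (ex.trans ey.symm)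
    fun w _ => hd w
  obtain ⟨b, hb, hb0⟩ := exists_hasDerivAt_eq_zero hyz hcont.continuousOn (ey.trans ez.symm)
    fun w _ => hd w
  have hc0 : c ≠ 0 := by
    intro h0
    rw [h0] at ex
    simp at ex
  have hapos : 0 < a := hx.trans ha.1
  have hbpos : 0 < b := by linarith [hb.1]
  have hab : a < b := ha.2.trans hb.1
  have ea : ((n + 1) - (n + 3) * a ^ 2 : ℝ) = 0 := by
    simpa [hc0, hapos.ne'] using ha0
  have eb : ((n + 1) - (n + 3) * b ^ 2 : ℝ) = 0 := by
    simpa [hc0, hbpos.ne'] using hb0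
  have h2 : a ^ 2 < b ^ 2 := by gcongr
  have : (0 : ℝ) < n + 3 := by positivity
  nlinarith

/-- `H''` has at most two zeros in `J`. -/
def FewInflections (p : ℕ) (β : ℝ) (J : Set ℝ) : Prop :=
  J.OrdConnected ∧ J ⊆ Ioo (-1) 1 ∧ ∀ x ∈ J, ∀ y ∈ J, ∀ z ∈ J, x < y → y < z →
    curv p β x = 0 → curv p β y = 0 → curv p β z = 0 → False

theorem curv_zero_neg {p : ℕ} (hp : 3 ≤ p) (β : ℝ) : curv p β 0 = -1 := by
  simp [curv, show p - 2 ≠ 0 by omega]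

theorem curv_neg_of_odd {p : ℕ} (hp : 3 ≤ p) (hodd : Odd p) {β x : ℝ} (hβ : 0 ≤ β)
    (hx1 : -1 < x) (hx : x ≤ 0) : curv p β x < 0 := by
  have ho : Odd (p - 2) := Nat.Odd.sub_even (by omega) hodd (by decide)
  have h1 : x ^ (p - 2) ≤ 0 := ho.pow_nonpos hx
  have h2 : 0 < 1 / (1 - x ^ 2) := by
    have : 0 < 1 - x ^ 2 := by nlinarith
    positivity
  have h3 : β * (p * ((p - 1 : ℕ) * x ^ (p - 2))) ≤ 0 :=
    mul_nonpos_of_nonneg_of_nonpos hβ (mul_nonpos_of_nonneg_of_nonpos (by positivity)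
      (mul_nonpos_of_nonneg_of_nonpos (by positivity) h1))
  unfold curv
  linarith

theorem fewInflections_of_odd {p : ℕ} (hp : 3 ≤ p) (hodd : Odd p) {β : ℝ} (hβ : 0 ≤ β) :
    FewInflections p β (Ioo (-1) 1) := by
  refine ⟨ordConnected_Ioo, subset_rfl, fun x hx y _ z hz hxy hyz cx cy cz => ?_⟩
  refine curv_zeros_pos hp ?_ hxy hyz hz.2 cx cy cz
  by_contra! h0
  exact (curv_neg_of_odd hp hodd hβ hx.1 h0).ne cx

theorem fewInflections_Ico {p : ℕ} (hp : 3 ≤ p) (β : ℝ) : FewInflections p β (Ico 0 1) := by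
  refine ⟨ordConnected_Ico, fun x hx => ⟨by linarith [hx.1], hx.2⟩,
    fun x hx y _ z hz hxy hyz cx cy cz => ?_⟩
  refine curv_zeros_pos hp (lt_of_le_of_ne hx.1 ?_) hxy hyz hz.2 cx cy cz
  rintro rfl
  rw [curv_zero_neg hp] at cx
  norm_num at cx

/-- Rolle's theorem applied to `H'` puts an inflection in each of the three gaps. -/
theorem FewInflections.not_four {p : ℕ} {β h : ℝ} {J : Set ℝ} (hJ : FewInflections p β J)
    {a b c d : ℝ} (ha : a ∈ J) (hd : d ∈ J) (hab : a < b) (hbc : b < c) (hcd : c < d)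
    (sa : slope p β h a = 0) (sb : slope p β h b = 0) (sc : slope p β h c = 0)
    (sd : slope p β h d = 0) : False := by
  obtain ⟨ho, hsub, hz⟩ := hJ
  have hb : b ∈ J := ho.out ha hd ⟨hab.le, by linarith⟩
  have hc : c ∈ J := ho.out ha hd ⟨by linarith, by linarith⟩
  obtain ⟨x, hx, cx⟩ := exists_curv_eq_zero (hsub ha) (hsub hb) hab sa sb
  obtain ⟨y, hy, cy⟩ := exists_curv_eq_zero (hsub hb) (hsub hc) hbc sb sc
  obtain ⟨z, hz', cz⟩ := exists_curv_eq_zero (hsub hc) (hsub hd) hcd sc sd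
  exact hz x (ho.out ha hd ⟨hx.1.le, by linarith [hx.2]⟩) y
    (ho.out ha hd ⟨by linarith [hy.1], by linarith [hy.2]⟩) z
    (ho.out ha hd ⟨by linarith [hz'.1], hz'.2.le⟩) (by linarith [hx.2, hy.1])
    (by linarith [hy.2, hz'.1]) cx cy cz

/-- The two inflections that Rolle places strictly inside `(a, c)` exhaust the allowance, so neither
endpoint can be a third. This is the source of nondegeneracy. -/
theorem FewInflections.curv_ne_zero {p : ℕ} {β h : ℝ} {J : Set ℝ} (hJ : FewInflections p β J)
    {a b c : ℝ} (ha : a ∈ J) (hc : c ∈ J) (hab : a < b) (hbc : b < c)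
    (sa : slope p β h a = 0) (sb : slope p β h b = 0) (sc : slope p β h c = 0) :
    curv p β a ≠ 0 ∧ curv p β c ≠ 0 := by
  obtain ⟨ho, hsub, hz⟩ := hJ
  have hb : b ∈ J := ho.out ha hc ⟨hab.le, hbc.le⟩
  obtain ⟨x, hx, cx⟩ := exists_curv_eq_zero (hsub ha) (hsub hb) hab sa sb
  obtain ⟨y, hy, cy⟩ := exists_curv_eq_zero (hsub hb) (hsub hc) hbc sb sc
  have hxJ : x ∈ J := ho.out ha hc ⟨hx.1.le, by linarith [hx.2]⟩
  have hyJ : y ∈ J := ho.out ha hc ⟨by linarith [hy.1], hy.2.le⟩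
  have hxy : x < y := hx.2.trans hy.1
  exact ⟨fun h0 => hz a ha x hxJ y hyJ hx.1 hxy h0 cx cy,
    fun h0 => hz x hxJ y hyJ c hc hxy hy.2 cx cy h0⟩

/-- If all the maximizers lie in a region with at most two inflections and there are at least two of
them, then there are exactly two, both nondegenerate. -/
theorem FewInflections.exists_pair {p : ℕ} {β h : ℝ} {J : Set ℝ} (hJ : FewInflections p β J)
    (hsub : maximizers p β h ⊆ J) (hnt : (maximizers p β h).Nontrivial) :
    ∃ m₁ m₂, m₁ < m₂ ∧ maximizers p β h = {m₁, m₂} ∧ curv p β m₁ < 0 ∧ curv p β m₂ < 0 := by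
  obtain ⟨m₁, h₁, m₂, h₂, hlt⟩ := hnt.exists_lt
  -- `H` takes equal values at `a` and `b`, so another critical point lies between them, and with
  -- `a`, `b`, `c` that makes four.
  have three : ∀ a ∈ maximizers p β h, ∀ b ∈ maximizers p β h, ∀ c ∈ maximizers p β h,
      a < b → b < c → False := by
    intro a ha b hb c hc hab hbc
    obtain ⟨d, hd, sd⟩ := exists_slope_eq_zero (mem_Ioo_of_mem_maximizers ha)
      (mem_Ioo_of_mem_maximizers hb) hab (H_eq_of_mem_maximizers ha hb)
    exact hJ.not_four (hsub ha) (hsub hc) hd.1 hd.2 hbc (slope_eq_zero_of_mem_maximizers ha) sd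
      (slope_eq_zero_of_mem_maximizers hb) (slope_eq_zero_of_mem_maximizers hc)
  obtain ⟨d, hd, sd⟩ := exists_slope_eq_zero (mem_Ioo_of_mem_maximizers h₁)
    (mem_Ioo_of_mem_maximizers h₂) hlt (H_eq_of_mem_maximizers h₁ h₂)
  have hc := hJ.curv_ne_zero (hsub h₁) (hsub h₂) hd.1 hd.2 (slope_eq_zero_of_mem_maximizers h₁) sd
    (slope_eq_zero_of_mem_maximizers h₂)
  refine ⟨m₁, m₂, hlt, ?_, lt_of_le_of_ne (curv_nonpos_of_mem_maximizers h₁) hc.1,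
    lt_of_le_of_ne (curv_nonpos_of_mem_maximizers h₂) hc.2⟩
  apply Subset.antisymm
  · intro m hm
    by_contra hne
    simp only [mem_insert_iff, mem_singleton_iff, not_or] at hne
    rcases lt_or_gt_of_ne hne.1 with h | h
    · exact three m hm m₁ h₁ m₂ h₂ h hlt
    · rcases lt_or_gt_of_ne hne.2 with h' | h'
      · exact three m₁ h₁ m hm m₂ h₂ h h'
      · exact three m₁ h₁ m₂ h₂ m hm hlt h'
  · rintro m (rfl | rfl) <;> assumption

/-! ### Classification of the maximizers -/

theorem maximizers_of_odd {p : ℕ} (hp : 3 ≤ p) (hodd : Odd p) {β h : ℝ}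
    (hcrit : IsCritical p β h) :
    ∃ m₁ m₂, m₁ < m₂ ∧ m₁ ≠ -m₂ ∧ maximizers p β h = {m₁, m₂} ∧
      curv p β m₁ < 0 ∧ curv p β m₂ < 0 := by
  obtain ⟨m₁, m₂, hlt, hM, c₁, c₂⟩ := (fewInflections_of_odd hp hodd hcrit.1).exists_pair
    (h := h) (fun m hm => mem_Ioo_of_mem_maximizers hm) hcrit.2
  refine ⟨m₁, m₂, hlt, ?_, hM, c₁, c₂⟩
  -- As `p - 1` is even, subtracting the critical point equations at `±m₂` leaves `log(1 + m₂) =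
  -- log(1 - m₂)`, impossible for `m₂ > 0`.
  rintro rfl
  have h₁ : -m₂ ∈ maximizers p β h := by rw [hM]; simp
  have h₂ : m₂ ∈ maximizers p β h := by rw [hM]; simp
  have s₁ := slope_eq_zero_of_mem_maximizers h₁
  have s₂ := slope_eq_zero_of_mem_maximizers h₂
  have hi := mem_Ioo_of_mem_maximizers h₂
  have he : Even (p - 1) := Nat.Odd.sub_odd hodd odd_one
  simp only [slope, he.neg_pow, ← sub_eq_add_neg, sub_neg_eq_add] at s₁ s₂
  have h3 : Real.log (1 - m₂) < Real.log (1 + m₂) :=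
    Real.log_lt_log (by linarith [hi.2]) (by linarith)
  linarith

theorem H_neg_of_even {p : ℕ} (he : Even p) (β h x : ℝ) : H p β h (-x) = H p β (-h) x := by
  rw [H_neg, he.neg_one_pow, one_mul]

theorem neg_mem_maximizers {p : ℕ} (he : Even p) {β h m : ℝ} :
    -m ∈ maximizers p β h ↔ m ∈ maximizers p β (-h) := by
  simp only [maximizers, mem_ofPred_eq, H_neg_of_even he]
  refine and_congr ⟨fun H => ⟨by linarith [H.2], by linarith [H.1]⟩,
    fun H => ⟨by linarith [H.2], by linarith [H.1]⟩⟩ ⟨fun H x hx => ?_, fun H x hx => ?_⟩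
  · rw [← H_neg_of_even he]
    exact H (-x) ⟨by linarith [hx.2], by linarith [hx.1]⟩
  · rw [← neg_neg h, ← H_neg_of_even he]
    convert H (-x) ⟨by linarith [hx.2], by linarith [hx.1]⟩ using 1
    simp

theorem curv_neg_arg {p : ℕ} (he : Even p) (β x : ℝ) : curv p β (-x) = curv p β x := by
  have : Even (p - 2) := he.tsub (by decide)
  simp only [curv, this.neg_pow, neg_sq]

/-- For `h > 0` a negative point is beaten by its reflection, so all maximizers lie in `[0, 1)`,
where inflections are few. -/
theorem maximizers_of_even_of_pos {p : ℕ} (hp : 3 ≤ p) (he : Even p) {β h : ℝ} (hh : 0 < h)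
    (hnt : (maximizers p β h).Nontrivial) :
    ∃ m₁ m₂, m₁ < m₂ ∧ m₁ ≠ -m₂ ∧ maximizers p β h = {m₁, m₂} ∧
      curv p β m₁ < 0 ∧ curv p β m₂ < 0 := by
  have hsub : maximizers p β h ⊆ Ico 0 1 := by
    intro m hm
    refine ⟨?_, (mem_Ioo_of_mem_maximizers hm).2⟩
    by_contra! hneg
    have := hm.2 (-m) ⟨by linarith [hm.1.2], by linarith [hm.1.1]⟩
    simp only [H, entropyI_neg, he.neg_pow] at this
    nlinarith
  obtain ⟨m₁, m₂, hlt, hM, c₁, c₂⟩ := (fewInflections_Ico hp β).exists_pair hsub hnt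
  have h₁ : 0 ≤ m₁ := (hsub (hM ▸ mem_insert _ _)).1
  exact ⟨m₁, m₂, hlt, by linarith, hM, c₁, c₂⟩

theorem maximizers_of_even_of_ne {p : ℕ} (hp : 3 ≤ p) (he : Even p) {β h : ℝ} (hh : h ≠ 0)
    (hnt : (maximizers p β h).Nontrivial) :
    ∃ m₁ m₂, m₁ < m₂ ∧ m₁ ≠ -m₂ ∧ maximizers p β h = {m₁, m₂} ∧
      curv p β m₁ < 0 ∧ curv p β m₂ < 0 := by
  rcases lt_or_gt_of_ne hh with hneg | hpos
  · have himg : ∀ m, m ∈ maximizers p β h ↔ -m ∈ maximizers p β (-h) := fun m => by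
      rw [neg_mem_maximizers he, neg_neg]
    have hnt' : (maximizers p β (-h)).Nontrivial := by
      obtain ⟨a, ha, b, hb, hab⟩ := hnt
      exact ⟨-a, (himg a).1 ha, -b, (himg b).1 hb, by simpa using hab⟩
    obtain ⟨m₁, m₂, hlt, hne, hM, c₁, c₂⟩ := maximizers_of_even_of_pos hp he (neg_pos.2 hneg) hnt'
    refine ⟨-m₂, -m₁, by linarith, fun h0 => hne (by linarith), ?_, ?_, ?_⟩
    · ext m
      rw [himg, hM]
      simp only [mem_insert_iff, mem_singleton_iff, neg_eq_iff_eq_neg]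
      tauto
    · rwa [curv_neg_arg he]
    · rwa [curv_neg_arg he]
  · exact maximizers_of_even_of_pos hp he hpos hnt

theorem H_zero (p : ℕ) (hp : 3 ≤ p) (β h : ℝ) : H p β h 0 = 0 := by
  simp [H, entropyI, show p ≠ 0 by omega]

theorem slope_zero {p : ℕ} (hp : 3 ≤ p) (β : ℝ) : slope p β 0 0 = 0 := by
  simp [slope, show p - 1 ≠ 0 by omega]

/-- Since `H(0) = 0` and `H''(0) = -1`, `H` is negative just to the right of `0`, yet `H(m) ≥ 0`. It
therefore returns to `0` somewhere in `(0, m]`, and Rolle applies between the two zeros. The origin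
need not be a maximizer. -/
theorem exists_slope_eq_zero_between {p : ℕ} (hp : 3 ≤ p) {β m : ℝ}
    (hm : m ∈ maximizers p β 0) (hpos : 0 < m) : ∃ c ∈ Ioo 0 m, slope p β 0 c = 0 := by
  have hi := mem_Ioo_of_mem_maximizers hm
  have h0i : (0 : ℝ) ∈ Ioo (-1 : ℝ) 1 := by norm_num
  obtain ⟨δ, hδ, hq⟩ := abs_H_sub_quadratic_le (p := p) (β := β) h0i (slope_zero hp β)
    (ε := 1 / 4) (by norm_num)
  obtain ⟨u, hu0, hu⟩ : ∃ u, 0 < u ∧ u < min δ m := exists_between (lt_min hδ hpos)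
  have h1 := hq u (by rw [abs_of_pos hu0]; exact hu.trans_le (min_le_left _ _))
  rw [curv_zero_neg hp, zero_add, H_zero p hp] at h1
  have h2 := (abs_le.1 h1).2
  have hum : u < m := hu.trans_le (min_le_right _ _)
  have h3 : H p β 0 u < 0 := by nlinarith
  have h4 : 0 ≤ H p β 0 m := by simpa only [H_zero p hp] using hm.2 0 (by norm_num)
  obtain ⟨v, hv, hv0⟩ := intermediate_value_Icc hum.le (continuous_H p β 0).continuousOn
    (show (0 : ℝ) ∈ Icc _ _ from ⟨h3.le, h4⟩)
  have hv0' : 0 < v := hu0.trans_le hv.1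
  obtain ⟨c, hc, sc⟩ := exists_slope_eq_zero (p := p) (β := β) (h := 0) h0i
    ⟨by linarith, hv.2.trans_lt hi.2⟩ hv0' (by rw [H_zero p hp, hv0])
  exact ⟨c, ⟨hc.1, hc.2.trans_le hv.2⟩, sc⟩

/-- The origin is always critical, and a further critical point separates it from any positive
maximizer. Two positive maximizers would make four critical points in `[0, 1)`; one alone is the
last of three, hence nondegenerate. -/
theorem maximizers_of_even_of_zero {p : ℕ} (hp : 3 ≤ p) (he : Even p) {β : ℝ}
    (hnt : (maximizers p β 0).Nontrivial) :
    ∃ m, 0 < m ∧ -m ∈ maximizers p β 0 ∧ m ∈ maximizers p β 0 ∧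
      maximizers p β 0 ⊆ {-m, 0, m} ∧ curv p β m < 0 := by
  have hsymm : ∀ m, -m ∈ maximizers p β 0 ↔ m ∈ maximizers p β 0 := fun m => by
    rw [neg_mem_maximizers he, neg_zero]
  have habs : ∀ m, m ∈ maximizers p β 0 → |m| ∈ maximizers p β 0 := by
    intro m hm
    rcases abs_choice m with h | h <;> rw [h]
    exacts [hm, (hsymm m).2 hm]
  obtain ⟨m, hm, hpos⟩ : ∃ m ∈ maximizers p β 0, 0 < m := by
    obtain ⟨m, hm, hne⟩ := hnt.exists_ne 0
    exact ⟨|m|, habs m hm, abs_pos.2 hne⟩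
  have hJ := fewInflections_Ico hp β
  have h0J : (0 : ℝ) ∈ Ico (0 : ℝ) 1 := by norm_num
  have hmJ : ∀ m ∈ maximizers p β 0, 0 < m → m ∈ Ico (0 : ℝ) 1 := fun m hm h0 =>
    ⟨h0.le, (mem_Ioo_of_mem_maximizers hm).2⟩
  have huniq : ∀ a ∈ maximizers p β 0, ∀ b ∈ maximizers p β 0, 0 < a → a < b → False := by
    intro a ha b hb ha0 hab
    obtain ⟨c, hc, sc⟩ := exists_slope_eq_zero_between hp ha ha0
    exact hJ.not_four h0J (hmJ b hb (ha0.trans hab)) hc.1 hc.2 hab (slope_zero hp β) sc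
      (slope_eq_zero_of_mem_maximizers ha) (slope_eq_zero_of_mem_maximizers hb)
  refine ⟨m, hpos, (hsymm m).2 hm, hm, fun x hx => ?_, ?_⟩
  · by_contra hne
    simp only [mem_insert_iff, mem_singleton_iff, not_or] at hne
    have hx' := habs x hx
    have hx0 : 0 < |x| := abs_pos.2 hne.2.1
    rcases lt_trichotomy |x| m with h | h | h
    · exact huniq _ hx' _ hm hx0 h
    · rcases abs_choice x with h' | h'
      · exact hne.2.2 (by rw [← h, h'])
      · exact hne.1 (by rw [← h, h', neg_neg])
    · exact huniq _ hm _ hx' hpos h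
  · obtain ⟨c, hc, sc⟩ := exists_slope_eq_zero_between hp hm hpos
    exact lt_of_le_of_ne (curv_nonpos_of_mem_maximizers hm)
      (hJ.curv_ne_zero h0J (hmJ m hm hpos) hc.1 hc.2 (slope_zero hp β) sc
        (slope_eq_zero_of_mem_maximizers hm)).2

/-! ### The threshold -/

/-- Because `H(0) = 0`, the threshold condition says that the origin is a maximizer, a family of
closed conditions on `β`. -/
theorem sSup_H_eq_zero_iff {p : ℕ} (hp : 3 ≤ p) (β : ℝ) :
    sSup (H p β 0 '' Icc (-1 : ℝ) 1) = 0 ↔ (0 : ℝ) ∈ maximizers p β 0 := by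
  have hbdd : BddAbove (H p β 0 '' Icc (-1 : ℝ) 1) :=
    (isCompact_Icc.image (continuous_H p β 0)).bddAbove
  constructor
  · intro h
    refine ⟨by norm_num, fun x hx => ?_⟩
    rw [H_zero p hp]
    exact (le_csSup hbdd (mem_image_of_mem _ hx)).trans_eq h
  · intro h
    refine IsGreatest.csSup_eq ⟨⟨0, by norm_num, H_zero p hp β 0⟩, ?_⟩
    rintro _ ⟨x, hx, rfl⟩
    simpa only [H_zero p hp] using h.2 x hx

theorem bddAbove_threshold {p : ℕ} (hp : 3 ≤ p) :
    BddAbove {β : ℝ | 0 ≤ β ∧ sSup (H p β 0 '' Icc (-1 : ℝ) 1) = 0} := by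
  -- The bound comes from comparing `H` at `1` with `H` at `0`.
  refine ⟨entropyI 1, fun β hβ => ?_⟩
  have := ((sSup_H_eq_zero_iff hp β).1 hβ.2).2 1 (by norm_num)
  rw [H_zero p hp, H] at this
  simp only [one_pow, mul_one] at this
  linarith

/-- The set is closed, bounded and contains `0`, so the supremum is attained; this places the origin
among the maximizers at the threshold itself. -/
theorem betaTilde_mem {p : ℕ} (hp : 3 ≤ p) :
    betaTilde p ∈ {β : ℝ | 0 ≤ β ∧ sSup (H p β 0 '' Icc (-1 : ℝ) 1) = 0} := by
  unfold betaTilde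
  refine IsClosed.csSup_mem ?_ ⟨0, le_refl _, ?_⟩ (bddAbove_threshold hp)
  · have : {β : ℝ | 0 ≤ β ∧ sSup (H p β 0 '' Icc (-1 : ℝ) 1) = 0}
        = Ici 0 ∩ ⋂ x ∈ Icc (-1 : ℝ) 1, {β | H p β 0 x ≤ H p β 0 0} := by
      ext β
      simp only [sSup_H_eq_zero_iff hp, maximizers, mem_ofPred_eq, mem_inter_iff, mem_iInter,
        mem_Ici]
      exact and_congr_right fun _ => and_iff_right (by norm_num)
    rw [this]
    refine isClosed_Ici.inter (isClosed_biInter fun x _ => isClosed_le ?_ ?_)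
    all_goals
      unfold H
      fun_prop
  · rw [sSup_H_eq_zero_iff hp]
    refine ⟨by norm_num, fun x hx => ?_⟩
    rw [H_zero p hp, H]
    -- The bound `t log t ≥ t - 1` at `t = 1 ± x` gives `x` and `-x`, which cancel: the entropy is
    -- nonnegative.
    have h1 := Real.self_sub_one_le_mul_log (x := 1 + x) (by linarith [hx.1])
    have h2 := Real.self_sub_one_le_mul_log (x := 1 - x) (by linarith [hx.2])
    unfold entropyI
    linarith

theorem zero_mem_maximizers_of_eq_betaTilde {p : ℕ} (hp : 3 ≤ p) {β : ℝ} (hβ : β = betaTilde p) :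
    (0 : ℝ) ∈ maximizers p β 0 := by
  rw [← sSup_H_eq_zero_iff hp, hβ]
  exact (betaTilde_mem hp).2

theorem zero_notMem_maximizers_of_betaTilde_lt {p : ℕ} (hp : 3 ≤ p) {β : ℝ}
    (hβ : betaTilde p < β) : (0 : ℝ) ∉ maximizers p β 0 := by
  rw [← sSup_H_eq_zero_iff hp]
  exact fun h => hβ.not_ge (le_csSup (bddAbove_threshold hp)
    ⟨(betaTilde_mem hp).1.trans hβ.le, h⟩)

/-! ### Reduction to the magnetization -/

/-- The magnetization per site. -/
def mag {N : ℕ} (x : SpinConfig N) : ℝ := (∑ i, spin x i) / N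

/-- The value of the magnetization of a configuration of size `N` with `k` plus spins. -/
def site (N k : ℕ) : ℝ := 2 * k / N - 1

/-- The set of plus spins of a configuration. -/
def plusSpins {N : ℕ} (x : SpinConfig N) : Finset (Fin N) :=
  Finset.univ.filter fun i => spin x i = 1

theorem spin_eq_one_or {N : ℕ} (x : SpinConfig N) (i : Fin N) : spin x i = 1 ∨ spin x i = -1 := by
  rcases Int.units_eq_one_or (x i) with h | h <;> simp [spin, h]

theorem sum_spin {N : ℕ} (x : SpinConfig N) :
    ∑ i, spin x i = 2 * ((plusSpins x).card : ℝ) - N := by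
  have h : ∀ i, spin x i = 2 * (if spin x i = 1 then 1 else 0) - 1 := by
    intro i
    rcases spin_eq_one_or x i with h | h <;> rw [h] <;> norm_num
  rw [Finset.sum_congr rfl fun i _ => h i]
  simp only [Finset.sum_sub_distrib, ← Finset.mul_sum, Finset.sum_boole]
  simp [plusSpins]

theorem mag_eq_site {N : ℕ} (hN : N ≠ 0) (x : SpinConfig N) :
    mag x = site N (plusSpins x).card := by
  have : (N : ℝ) ≠ 0 := by exact_mod_cast hN
  rw [mag, sum_spin, site]
  field_simp

/-- Configurations correspond to their sets of plus spins. -/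
def plusEquiv (N : ℕ) : SpinConfig N ≃ Finset (Fin N) where
  toFun := plusSpins
  invFun s := fun i => if i ∈ s then 1 else -1
  left_inv x := by
    funext i
    have hmem : i ∈ plusSpins x ↔ spin x i = 1 := by simp [plusSpins]
    rcases Int.units_eq_one_or (x i) with h | h <;> simp only [hmem, spin, h] <;> norm_num
  right_inv s := by
    ext i
    by_cases h : i ∈ s <;> simp [plusSpins, spin, h]

theorem sum_comp_card (N : ℕ) (φ : ℕ → ℝ) :
    ∑ x : SpinConfig N, φ (plusSpins x).card
      = ∑ k ∈ Finset.range (N + 1), (N.choose k : ℝ) * φ k := by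
  rw [Fintype.sum_equiv (plusEquiv N) (fun x => φ (plusSpins x).card) (fun s => φ s.card)
    fun x => rfl]
  have := Finset.sum_powerset_apply_card φ (x := (Finset.univ : Finset (Fin N)))
  rw [Finset.powerset_univ] at this
  simpa using this

/-- The sum over `p`-tuples of products of spins is the `p`-th power of the total spin, so the
energy depends on the magnetization alone. -/
theorem exponent_eq {p : ℕ} (hp : 1 ≤ p) (β h : ℝ) {N : ℕ} (hN : N ≠ 0) (x : SpinConfig N) :
    exponent p β h x = N * (β * mag x ^ p + h * mag x) := by
  have hN' : (N : ℝ) ≠ 0 := by exact_mod_cast hN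
  obtain ⟨n, rfl⟩ : ∃ n, p = n + 1 := ⟨p - 1, by omega⟩
  simp only [exponent, mag, ← Fintype.sum_pow, Nat.add_sub_cancel, div_pow]
  field_simp
  ring

/-- The (unnormalized) mass of the configurations with `k` plus spins. -/
def siteMass (p : ℕ) (β h : ℝ) (N k : ℕ) : ℝ :=
  (N.choose k : ℝ) * (1 / 2) ^ N * Real.exp (N * (β * site N k ^ p + h * site N k))

theorem siteMass_nonneg (p : ℕ) (β h : ℝ) (N k : ℕ) : 0 ≤ siteMass p β h N k := by
  unfold siteMass
  positivity

theorem sum_exp_exponent_mul {p : ℕ} (hp : 1 ≤ p) (β h : ℝ) {N : ℕ} (hN : N ≠ 0) (g : ℝ → ℝ) :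
    ∑ x : SpinConfig N, Real.exp (exponent p β h x) * g (mag x)
      = 2 ^ N * ∑ k ∈ Finset.range (N + 1), siteMass p β h N k * g (site N k) := by
  simp only [exponent_eq hp β h hN, mag_eq_site hN]
  rw [sum_comp_card N fun k =>
    Real.exp (N * (β * site N k ^ p + h * site N k)) * g (site N k), Finset.mul_sum]
  refine Finset.sum_congr rfl fun k _ => ?_
  simp only [siteMass, one_div, inv_pow]
  field_simp

theorem sum_likelihood_mul {p : ℕ} (hp : 1 ≤ p) (β h : ℝ) {N : ℕ} (hN : N ≠ 0) (g : ℝ → ℝ) :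
    ∑ x : SpinConfig N, likelihood p β h x * g (mag x)
      = (∑ k ∈ Finset.range (N + 1), siteMass p β h N k * g (site N k))
        / ∑ k ∈ Finset.range (N + 1), siteMass p β h N k := by
  have h1 := sum_exp_exponent_mul hp β h hN g
  have h2 := sum_exp_exponent_mul hp β h hN fun _ => 1
  simp only [mul_one] at h2
  have h3 : (2 : ℝ) ^ N * partitionFunction p β h N
      = ∑ x : SpinConfig N, Real.exp (exponent p β h x) := by
    unfold partitionFunction
    field_simp
  simp only [likelihood, h3, div_mul_eq_mul_div, ← Finset.sum_div]
  rw [h1, h2, mul_div_mul_left _ _ (by positivity)]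

/-! ### Stirling's formula for binomial coefficients -/

/-- The subexponential factor of the binomial coefficient. -/
def stirlingCoeff (N k : ℕ) : ℝ :=
  Stirling.stirlingSeq N / (Stirling.stirlingSeq k * Stirling.stirlingSeq (N - k)) *
    √(N / (2 * k * (N - k : ℕ)))

theorem stirlingSeq_pos {n : ℕ} (hn : n ≠ 0) : 0 < Stirling.stirlingSeq n := by
  obtain ⟨k, rfl⟩ := Nat.exists_eq_succ_of_ne_zero hn
  exact Stirling.stirlingSeq'_pos k

theorem factorial_eq_stirlingSeq {n : ℕ} (hn : n ≠ 0) :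
    (n.factorial : ℝ) = Stirling.stirlingSeq n * √(2 * n) * Real.exp (n * Real.log n - n) := by
  have h0 : (0 : ℝ) < n := by exact_mod_cast Nat.pos_of_ne_zero hn
  have : Real.exp (n * Real.log n - n) = (n / Real.exp 1) ^ n := by
    rw [Real.exp_sub, mul_comm, Real.exp_mul, Real.exp_log h0, Real.rpow_natCast, div_pow,
      ← Real.exp_nat_mul, mul_one]
  rw [this, Stirling.stirlingSeq, mul_assoc, div_mul_cancel₀]
  positivity

/-- The factors `(n/e)^n` of the three factorials combine exactly into the entropy exponential. No
limit is taken, so the identity serves both for bounds and for asymptotics. -/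
theorem choose_eq_stirlingCoeff {N k : ℕ} (hk : 0 < k) (hkN : k < N) :
    (N.choose k : ℝ) * (1 / 2) ^ N = stirlingCoeff N k * Real.exp (-(N * entropyI (site N k))) := by
  obtain ⟨l, rfl⟩ := Nat.exists_eq_add_of_lt hkN
  set l' := l + 1 with hl'
  have hN : k + l + 1 = k + l' := by omega
  rw [hN]
  have hk0 : (0 : ℝ) < k := by exact_mod_cast hk
  have hl0 : (0 : ℝ) < (l' : ℝ) := by positivity
  have hsk := stirlingSeq_pos hk.ne'
  have hsl := stirlingSeq_pos (n := l') (by omega)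
  rw [Nat.cast_add_choose ℝ, factorial_eq_stirlingSeq (n := k + l') (by omega),
    factorial_eq_stirlingSeq hk.ne', factorial_eq_stirlingSeq (n := l') (by omega)]
  rw [stirlingCoeff, Nat.add_sub_cancel_left]
  have hent : Real.exp (-(((k + l' : ℕ) : ℝ) * entropyI (site (k + l') k)))
      = Real.exp (((k + l' : ℕ) : ℝ) * Real.log (k + l' : ℕ) - (k + l' : ℕ)) * (1 / 2) ^ (k + l')
        / (Real.exp (k * Real.log k - k) * Real.exp (l' * Real.log l' - l')) := by
    have h2 : ((1 : ℝ) / 2) ^ (k + l') = Real.exp (-((k + l' : ℕ) * Real.log 2)) := by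
      rw [Real.exp_neg, mul_comm, Real.exp_mul, Real.exp_log two_pos, Real.rpow_natCast, one_div,
        inv_pow]
    rw [h2, ← Real.exp_add, ← Real.exp_add, ← Real.exp_sub]
    congr 1
    have e1 : 1 + site (k + l') k = 2 * k / (k + l') := by
      rw [site]; push_cast; ring
    have e2 : 1 - site (k + l') k = 2 * l' / (k + l') := by
      rw [site]; push_cast; field_simp; ring
    rw [entropyI, e1, e2, Real.log_div (by positivity) (by positivity),
      Real.log_div (by positivity) (by positivity), Real.log_mul two_ne_zero hk0.ne',
      Real.log_mul two_ne_zero hl0.ne']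
    push_cast
    field_simp
    ring
  have hsq : √(((k + l' : ℕ) : ℝ) / (2 * k * l')) = √(2 * (k + l' : ℕ)) / (√(2 * k) * √(2 * l')) := by
    rw [← Real.sqrt_mul (by positivity), ← Real.sqrt_div (by positivity)]
    congr 1
    field_simp
  rw [hent, hsq]
  field_simp

theorem siteMass_eq {p : ℕ} (β h : ℝ) {N k : ℕ} (hk : 0 < k) (hkN : k < N) :
    siteMass p β h N k = stirlingCoeff N k * Real.exp (N * H p β h (site N k)) := by
  rw [siteMass, choose_eq_stirlingCoeff hk hkN, mul_assoc, ← Real.exp_add, H]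
  congr 2
  ring

theorem stirlingSeq_le {n : ℕ} (hn : n ≠ 0) : Stirling.stirlingSeq n ≤ Stirling.stirlingSeq 1 := by
  obtain ⟨k, rfl⟩ := Nat.exists_eq_succ_of_ne_zero hn
  exact Stirling.stirlingSeq'_antitone (Nat.zero_le k)

theorem stirlingCoeff_nonneg (N k : ℕ) : 0 ≤ stirlingCoeff N k := by
  unfold stirlingCoeff Stirling.stirlingSeq
  positivity

theorem stirlingCoeff_le {N k : ℕ} (hk : 0 < k) (hkN : k < N) :
    stirlingCoeff N k ≤ Stirling.stirlingSeq 1 / Real.pi * √(N / (2 * k * (N - k : ℕ))) := by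
  have h1 := stirlingSeq_le (n := N) (by omega)
  have h2 := Stirling.sqrt_pi_le_stirlingSeq hk.ne'
  have h3 := Stirling.sqrt_pi_le_stirlingSeq (n := N - k) (by omega)
  have h0 := stirlingSeq_pos one_ne_zero
  have h4 : Real.pi ≤ Stirling.stirlingSeq k * Stirling.stirlingSeq (N - k) := by
    calc Real.pi = √Real.pi * √Real.pi := (Real.mul_self_sqrt Real.pi_pos.le).symm
      _ ≤ _ := mul_le_mul h2 h3 (by positivity) ((Real.sqrt_nonneg _).trans h2)
  unfold stirlingCoeff
  gcongr

/-- A crude bound up to the extreme sites, used far from the maximizers. For `k = 0` and `k = N`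
Stirling is unavailable, but the binomial coefficient is `1` and the entropy is `log 2`; the `+ 1`
in the constant covers them. Elsewhere `N ≤ 2k(N - k)`. -/
theorem siteMass_le {p : ℕ} (β h : ℝ) {N k : ℕ} (hN : N ≠ 0) (hkN : k ≤ N) :
    siteMass p β h N k
      ≤ (Stirling.stirlingSeq 1 / Real.pi + 1) * Real.exp (N * H p β h (site N k)) := by
  have hN' : (N : ℝ) ≠ 0 := by exact_mod_cast hN
  have h0 := (stirlingSeq_pos one_ne_zero).le
  have hS : 0 ≤ Stirling.stirlingSeq 1 / Real.pi := div_nonneg h0 Real.pi_pos.le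
  have hpow : ((1 : ℝ) / 2) ^ N = Real.exp (-(N * Real.log 2)) := by
    rw [Real.exp_neg, mul_comm, Real.exp_mul, Real.exp_log two_pos, Real.rpow_natCast, one_div,
      inv_pow]
  have hedge : entropyI (site N k) = Real.log 2 → N.choose k = 1 →
      siteMass p β h N k = Real.exp (N * H p β h (site N k)) := by
    intro he hc
    rw [siteMass, hc, Nat.cast_one, one_mul, hpow, ← Real.exp_add, H, he]
    congr 1
    ring
  have hle : Real.exp (N * H p β h (site N k))
      ≤ (Stirling.stirlingSeq 1 / Real.pi + 1) * Real.exp (N * H p β h (site N k)) :=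
    le_mul_of_one_le_left (Real.exp_pos _).le (by linarith)
  rcases Nat.eq_zero_or_pos k with rfl | hk
  · refine (hedge ?_ (Nat.choose_zero_right N)).trans_le hle
    norm_num [site, entropyI]
    ring
  rcases hkN.eq_or_lt with rfl | hlt
  · refine (hedge ?_ (Nat.choose_self k)).trans_le hle
    have : site k k = 1 := by
      rw [site]; field_simp; norm_num
    norm_num [this, entropyI]
    ring
  rw [siteMass_eq β h hk hlt]
  gcongr
  refine (stirlingCoeff_le hk hlt).trans ?_
  have : √((N : ℝ) / (2 * k * (N - k : ℕ))) ≤ 1 := by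
    rw [Real.sqrt_le_one, div_le_one (by
      have : 0 < N - k := by omega
      positivity)]
    obtain ⟨l, rfl⟩ := Nat.exists_eq_add_of_lt hlt
    obtain ⟨j, rfl⟩ : ∃ j, k = j + 1 := ⟨k - 1, by omega⟩
    rw [show j + 1 + l + 1 - (j + 1) = l + 1 by omega]
    push_cast
    have : (0 : ℝ) ≤ j * l := by positivity
    nlinarith [(Nat.cast_nonneg j : (0 : ℝ) ≤ j), (Nat.cast_nonneg l : (0 : ℝ) ≤ l)]
  linarith [mul_le_of_le_one_right hS this]

theorem site_mem_Icc {N k : ℕ} (hN : N ≠ 0) (hkN : k ≤ N) : site N k ∈ Icc (-1 : ℝ) 1 := by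
  have hN' : (0 : ℝ) < N := by exact_mod_cast Nat.pos_of_ne_zero hN
  have hk : (k : ℝ) ≤ N := by exact_mod_cast hkN
  rw [site]
  constructor
  · have : 0 ≤ 2 * (k : ℝ) / N := by positivity
    linarith
  · have : 2 * (k : ℝ) / N ≤ 2 := by
      rw [div_le_iff₀ hN']; linarith
    linarith

/-! ### Sums as integrals of step functions -/

/-- The function equal to `φ k` on `[k, k + 1)` for `k < n`, and to `0` elsewhere. -/
def stepFun (n : ℕ) (φ : ℕ → ℝ) (u : ℝ) : ℝ :=
  ∑ k ∈ Finset.range n, (Ico (k : ℝ) (k + 1)).indicator (fun _ => φ k) u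

theorem stepFun_apply (n : ℕ) (φ : ℕ → ℝ) (u : ℝ) :
    stepFun n φ u = if 0 ≤ u ∧ ⌊u⌋₊ < n then φ ⌊u⌋₊ else 0 := by
  have hmem : ∀ k : ℕ, u ∈ Ico (k : ℝ) (k + 1) ↔ 0 ≤ u ∧ ⌊u⌋₊ = k := by
    intro k
    constructor
    · intro h
      have h0 : 0 ≤ u := (Nat.cast_nonneg k).trans h.1
      exact ⟨h0, (Nat.floor_eq_iff h0).2 h⟩
    · rintro ⟨h0, h⟩
      exact (Nat.floor_eq_iff h0).1 h
  simp only [stepFun, indicator_apply, hmem]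
  by_cases h0 : 0 ≤ u
  · simp [h0, Finset.sum_ite_eq]
  · simp [h0]

theorem measurable_stepFun (n : ℕ) (φ : ℕ → ℝ) : Measurable (stepFun n φ) :=
  Finset.measurable_sum _ fun _ _ => measurable_const.indicator measurableSet_Ico

theorem integral_stepFun (n : ℕ) (φ : ℕ → ℝ) :
    ∫ u, stepFun n φ u = ∑ k ∈ Finset.range n, φ k := by
  unfold stepFun
  rw [integral_finsetSum _ fun k _ => ?_]
  · refine Finset.sum_congr rfl fun k _ => ?_
    rw [integral_indicator_const _ measurableSet_Ico]
    simp
  · exact (integrable_indicator_iff measurableSet_Ico).2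
      (integrableOn_const (by simp))

/-- Turns a sum over sites into an integral in the rescaled variable `y`, making dominated
convergence available. -/
theorem integral_stepFun_affine (n : ℕ) (φ : ℕ → ℝ) (d : ℝ) {c : ℝ} (hc : 0 < c) :
    ∫ y, c * stepFun n φ (d + c * y) = ∑ k ∈ Finset.range n, φ k := by
  rw [integral_const_mul, Measure.integral_comp_mul_left (fun y => stepFun n φ (d + y)) c,
    integral_add_left_eq_self (stepFun n φ) d, integral_stepFun, abs_of_pos (inv_pos.2 hc),
    smul_eq_mul, mul_inv_cancel_left₀ hc.ne']

/-! ### Local asymptotics near a nondegenerate maximizer -/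

theorem tendsto_scaled_H {p : ℕ} {β h m : ℝ} (hm : m ∈ Ioo (-1 : ℝ) 1)
    (hs : slope p β h m = 0) {t : ℕ → ℝ} {y : ℝ} (ht : Tendsto t atTop (𝓝 y)) :
    Tendsto (fun N : ℕ => (N : ℝ) * (H p β h (m + t N / √N) - H p β h m)) atTop
      (𝓝 (curv p β m / 2 * y ^ 2)) := by
  have hsq : Tendsto (fun N : ℕ => √(N : ℝ)) atTop atTop :=
    Real.tendsto_sqrt_atTop.comp tendsto_natCast_atTop_atTop
  have h1 : Tendsto (fun N => curv p β m / 2 * t N ^ 2) atTop (𝓝 (curv p β m / 2 * y ^ 2)) :=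
    (ht.pow 2).const_mul _
  have h2 : Tendsto (fun N : ℕ => (N : ℝ) * (H p β h (m + t N / √N) - H p β h m)
      - curv p β m / 2 * t N ^ 2) atTop (𝓝 0) := by
    rw [Metric.tendsto_nhds]
    intro ε hε
    -- Eventually `t N ^ 2 < y² + 1`, so this tolerance keeps the scaled Taylor error below `ε`.
    obtain ⟨δ, hδ, hq⟩ := abs_H_sub_quadratic_le hm hs (ε := ε / (y ^ 2 + 1)) (by positivity)
    have h3 : ∀ᶠ N : ℕ in atTop, |t N / √N| < δ := by
      have := (ht.div_atTop hsq).abs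
      rw [abs_zero] at this
      exact this.eventually (gt_mem_nhds hδ)
    have h4 : ∀ᶠ N : ℕ in atTop, t N ^ 2 < y ^ 2 + 1 :=
      (ht.pow 2).eventually (gt_mem_nhds (by linarith))
    filter_upwards [h3, h4, eventually_gt_atTop 0] with N h3 h4 hN
    have hN' : (0 : ℝ) < N := by exact_mod_cast hN
    have h5 := hq _ h3
    have h6 : (t N / √N) ^ 2 = t N ^ 2 / N := by rw [div_pow, Real.sq_sqrt hN'.le]
    rw [h6] at h5
    rw [Real.dist_eq, sub_zero]
    calc _ = (N : ℝ) * |H p β h (m + t N / √N) - H p β h m - curv p β m / 2 * (t N ^ 2 / N)| := by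
          rw [← abs_of_pos hN', ← abs_mul, abs_of_pos hN']
          congr 1
          field_simp
      _ ≤ (N : ℝ) * (ε / (y ^ 2 + 1) * (t N ^ 2 / N)) := by gcongr
      _ = ε * (t N ^ 2 / (y ^ 2 + 1)) := by field_simp
      _ < ε * 1 := by
          gcongr
          rw [div_lt_one (by positivity)]
          exact h4
      _ = ε := mul_one ε
  simpa using h2.add h1

theorem site_add_one (N k : ℕ) : 1 + site N k = 2 * k / N := by
  rw [site]; ring

theorem pos_and_lt_of_site_mem {N k : ℕ} (hN : N ≠ 0) (hx : site N k ∈ Ioo (-1 : ℝ) 1) :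
    0 < k ∧ k < N := by
  have hN' : (0 : ℝ) < N := by exact_mod_cast Nat.pos_of_ne_zero hN
  have h1 := site_add_one N k
  constructor
  · rcases Nat.eq_zero_or_pos k with rfl | h
    · simp at h1; linarith [hx.1]
    · exact h
  · have h2 : 2 * (k : ℝ) / N < 2 := by linarith [hx.2]
    rw [div_lt_iff₀ hN'] at h2
    exact_mod_cast (by linarith : (k : ℝ) < N)

theorem sqrt_mul_sqrt_site {N k : ℕ} (hk : 0 < k) (hkN : k < N) :
    √(N : ℝ) * √(N / (2 * k * (N - k : ℕ))) = √(2 / (1 - site N k ^ 2)) := by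
  have hN' : (0 : ℝ) < N := by exact_mod_cast hk.trans hkN
  rw [← Real.sqrt_mul hN'.le]
  congr 1
  have h1 : (0 : ℝ) < k := by exact_mod_cast hk
  have h2 : (k : ℝ) < N := by exact_mod_cast hkN
  have h3 : 1 - site N k ^ 2 = 4 * k * (N - k) / N ^ 2 := by
    rw [site]
    field_simp
    ring
  have h4 : (N : ℝ) - k ≠ 0 := by linarith
  rw [h3, Nat.cast_sub hkN.le]
  field_simp
  norm_num

/-- The rescaled sites have spacing `2/√N`, so the factor `√N/2` turns masses into densities. Since
`m` is interior, `k` and `N - k` both diverge and every Stirling factor tends to `√π`. -/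
theorem tendsto_stirlingCoeff {k : ℕ → ℕ} {m : ℝ} (hm : m ∈ Ioo (-1 : ℝ) 1)
    (hk : Tendsto (fun N => site N (k N)) atTop (𝓝 m)) :
    Tendsto (fun N : ℕ => √(N : ℝ) / 2 * stirlingCoeff N (k N)) atTop
      (𝓝 (1 / √(2 * Real.pi * (1 - m ^ 2)))) := by
  have hN : Tendsto (fun N : ℕ => (N : ℝ)) atTop atTop := tendsto_natCast_atTop_atTop
  have hin : ∀ᶠ N : ℕ in atTop, 0 < k N ∧ k N < N := by
    filter_upwards [hk.eventually (isOpen_Ioo.mem_nhds hm), eventually_ne_atTop 0] with N h1 h2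
    exact pos_and_lt_of_site_mem h2 h1
  have hk1 : Tendsto k atTop atTop := by
    rw [← tendsto_natCast_atTop_iff (R := ℝ)]
    have : Tendsto (fun N : ℕ => (N : ℝ) * ((1 + site N (k N)) / 2)) atTop atTop :=
      hN.atTop_mul_pos (by linarith [hm.1] : 0 < (1 + m) / 2) ((hk.const_add 1).div_const 2)
    refine this.congr' ?_
    filter_upwards [eventually_ne_atTop 0] with N h0
    have : (N : ℝ) ≠ 0 := by exact_mod_cast h0
    rw [site_add_one]
    field_simp
  have hk2 : Tendsto (fun N => N - k N) atTop atTop := by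
    rw [← tendsto_natCast_atTop_iff (R := ℝ)]
    have : Tendsto (fun N : ℕ => (N : ℝ) * ((1 - site N (k N)) / 2)) atTop atTop :=
      hN.atTop_mul_pos (by linarith [hm.2] : 0 < (1 - m) / 2) ((hk.const_sub 1).div_const 2)
    refine this.congr' ?_
    filter_upwards [hin] with N h0
    have : (N : ℝ) ≠ 0 := by
      have := h0.1.trans h0.2
      positivity
    rw [site, Nat.cast_sub h0.2.le]
    field_simp
    ring
  have hs := Stirling.tendsto_stirlingSeq_sqrt_pi
  have hpi : 0 < √Real.pi := Real.sqrt_pos.2 Real.pi_pos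
  have hm2 : 0 < 1 - m ^ 2 := by nlinarith [hm.1, hm.2]
  have h1 : Tendsto (fun N => Stirling.stirlingSeq N /
      (Stirling.stirlingSeq (k N) * Stirling.stirlingSeq (N - k N))) atTop
      (𝓝 (√Real.pi / (√Real.pi * √Real.pi))) :=
    hs.div ((hs.comp hk1).mul (hs.comp hk2)) (by positivity)
  have h2 : Tendsto (fun N => √(2 / (1 - site N (k N) ^ 2))) atTop (𝓝 (√(2 / (1 - m ^ 2)))) :=
    (tendsto_const_nhds.div ((hk.pow 2).const_sub 1) hm2.ne').sqrt
  have h3 := (h1.mul h2).const_mul (1 / 2)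
  have hval : 1 / 2 * (√Real.pi / (√Real.pi * √Real.pi) * √(2 / (1 - m ^ 2)))
      = 1 / √(2 * Real.pi * (1 - m ^ 2)) := by
    rw [Real.sqrt_div zero_le_two, Real.sqrt_mul (by positivity), Real.sqrt_mul zero_le_two]
    have : √(1 - m ^ 2) ≠ 0 := (Real.sqrt_pos.2 hm2).ne'
    field_simp
    norm_num
  rw [hval] at h3
  refine h3.congr' ?_
  filter_upwards [hin] with N h0
  rw [← sqrt_mul_sqrt_site h0.1 h0.2, stirlingCoeff]
  ring

/-- Taking the floor moves the index by less than `1`, hence the site by less than `2/N`. -/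
theorem abs_scaled_site_sub_le {N : ℕ} (hN : N ≠ 0) {m y : ℝ}
    (hu : 0 ≤ N * (1 + m) / 2 + √N / 2 * y) :
    |√N * (site N ⌊N * (1 + m) / 2 + √N / 2 * y⌋₊ - m) - y| ≤ 2 / √N := by
  set u := N * (1 + m) / 2 + √N / 2 * y with hu'
  have hN' : (0 : ℝ) < N := by exact_mod_cast Nat.pos_of_ne_zero hN
  have hs : 0 < √(N : ℝ) := Real.sqrt_pos.2 hN'
  have hss : √(N : ℝ) * √N = N := Real.mul_self_sqrt hN'.le
  have h1 := Nat.floor_le hu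
  have h2 := Nat.lt_floor_add_one u
  have h3 : √N * (site N ⌊u⌋₊ - m) - y = 2 * (⌊u⌋₊ - u) / √N := by
    rw [eq_div_iff hs.ne', site]
    have : √(N : ℝ) * (2 * (⌊u⌋₊ : ℝ) / N - 1 - m) * √N = N * (2 * (⌊u⌋₊ : ℝ) / N - 1 - m) := by
      rw [mul_right_comm, hss]
    have hu2 : 2 * u = N * (1 + m) + √N * y := by rw [hu']; ring
    have he : (N : ℝ) * (2 * (⌊u⌋₊ : ℝ) / N - 1 - m) = 2 * ⌊u⌋₊ - N * (1 + m) := by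
      field_simp
      ring
    rw [sub_mul, this, he]
    linarith
  rw [h3, abs_div, abs_of_pos hs]
  gcongr
  rw [abs_le]
  constructor <;> linarith

theorem site_eq_add_div {N : ℕ} (hN : N ≠ 0) (k : ℕ) (m : ℝ) :
    site N k = m + √N * (site N k - m) / √N := by
  have hN' : (0 : ℝ) < N := by exact_mod_cast Nat.pos_of_ne_zero hN
  have hs : 0 < √(N : ℝ) := Real.sqrt_pos.2 hN'
  field_simp
  ring

/-- Supplies the integrable majorant. Completing the square absorbs the linear term into half of `c
t²`, and the other half dominates `c y²/4` up to a constant because `y² ≤ 2t² + 8`. -/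
theorem gaussian_exponent_le {b c t y : ℝ} (hc : 0 < c) (hty : |t - y| ≤ 2) :
    b * |t| - c * t ^ 2 ≤ b ^ 2 / (2 * c) + 2 * c + -(c / 4) * y ^ 2 := by
  have h1 : (t - y) ^ 2 ≤ 4 := by
    rw [← sq_abs]; nlinarith [abs_nonneg (t - y)]
  have h2 : y ^ 2 ≤ 2 * t ^ 2 + 8 := by nlinarith [sq_nonneg (2 * t - y)]
  have h3 : b * |t| ≤ b ^ 2 / (2 * c) + c / 2 * t ^ 2 := by
    have : 0 ≤ c / 2 * (|t| - b / c) ^ 2 := by positivity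
    have e : c / 2 * (|t| - b / c) ^ 2 = c / 2 * t ^ 2 - b * |t| + b ^ 2 / (2 * c) := by
      rw [sub_sq, sq_abs]
      field_simp
    linarith
  nlinarith

/-- The centered mass near a critical point, as a sequence of sums over sites. -/
def windowMass (p : ℕ) (β h m r : ℝ) (g : ℕ → ℝ → ℝ) (N k : ℕ) : ℝ :=
  if |site N k - m| < r then
    siteMass p β h N k * Real.exp (-(N * H p β h m)) * g N (site N k) else 0

/-- Laplace asymptotics of the mass near a nondegenerate critical point. -/
theorem tendsto_sum_windowMass {p : ℕ} {β h m : ℝ} (hm : m ∈ Ioo (-1 : ℝ) 1)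
    (hs : slope p β h m = 0) (hc : curv p β m < 0) :
    ∃ r₀ > 0, ∀ r, 0 < r → r ≤ r₀ → ∀ (g : ℕ → ℝ → ℝ) (f : ℝ → ℝ) (C b : ℝ), 0 ≤ C →
      (∀ N x, x ∈ Icc (-1 : ℝ) 1 → |g N x| ≤ C * Real.exp (b * (√N * |x - m|))) →
      (∀ᵐ y, ∀ t : ℕ → ℝ, Tendsto t atTop (𝓝 y) →
        Tendsto (fun N => g N (m + t N / √N)) atTop (𝓝 (f y))) →
      Tendsto (fun N => ∑ k ∈ Finset.range (N + 1), windowMass p β h m r g N k) atTop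
        (𝓝 (∫ y, 1 / √(2 * Real.pi * (1 - m ^ 2)) *
          (Real.exp (curv p β m / 2 * y ^ 2) * f y))) := by
  -- The quadratic part of `H` is `-2c u²`; a Taylor error of at most `c u²` leaves decay at least
  -- `c u²`.
  set c := -curv p β m / 4 with hcdef
  have hcpos : 0 < c := by linarith
  obtain ⟨δ, hδ, hq⟩ := abs_H_sub_quadratic_le hm hs hcpos
  -- A window of radius at most `(1 - |m|)/2` stays in `[-ρ, ρ]`, away from `±1`, where the Stirling
  -- coefficient is uniformly controlled.
  set ρ := (1 + |m|) / 2 with hρ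
  have habsm : |m| < 1 := abs_lt.2 hm
  have hρ1 : ρ < 1 := by linarith
  have hρ0 : 0 < ρ := by linarith [abs_nonneg m]
  refine ⟨min δ ((1 - |m|) / 2), lt_min hδ (by linarith), fun r hr hr₀ g f C b hC hg hf => ?_⟩
  have hrδ : r ≤ δ := hr₀.trans (min_le_left _ _)
  have hrρ : r ≤ (1 - |m|) / 2 := hr₀.trans (min_le_right _ _)
  have hwin : ∀ x, |x - m| < r → |x| ≤ ρ := fun x hx => by
    have := abs_add_le (x - m) m
    rw [sub_add_cancel] at this
    linarith
  have hsq : Tendsto (fun N : ℕ => √(N : ℝ)) atTop atTop :=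
    Real.tendsto_sqrt_atTop.comp tendsto_natCast_atTop_atTop
  have hkappa : ∀ {N k : ℕ}, N ≠ 0 → |site N k - m| < r → 0 < k ∧ k < N := fun hN hx =>
    pos_and_lt_of_site_mem hN (abs_lt.1 ((hwin _ hx).trans_lt hρ1))
  -- The change of variables `u = N(1 + m)/2 + (√N/2) y` makes `y` the limit of `√N` times the
  -- distance from the site to `m`.
  set Ψ : ℕ → ℝ → ℝ := fun N y => √N / 2 *
    stepFun (N + 1) (windowMass p β h m r g N) (N * (1 + m) / 2 + √N / 2 * y) with hΨ
  set K := Stirling.stirlingSeq 1 / Real.pi * √(2 / (1 - ρ ^ 2)) / 2 with hK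
  have hSpi : 0 ≤ Stirling.stirlingSeq 1 / Real.pi :=
    div_nonneg (stirlingSeq_pos one_ne_zero).le Real.pi_pos.le
  have hK0 : 0 ≤ K := by positivity
  have hΨint : Tendsto (fun N => ∫ y, Ψ N y) atTop
      (𝓝 (∫ y, 1 / √(2 * Real.pi * (1 - m ^ 2)) * (Real.exp (curv p β m / 2 * y ^ 2) * f y))) := by
    refine tendsto_integral_of_dominated_convergence
      (fun y => K * (C * Real.exp (b ^ 2 / (2 * c) + 2 * c)) * Real.exp (-(c / 4) * y ^ 2))
      (fun N => ?_) ?_ (fun N => Eventually.of_forall fun y => ?_) ?_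
    · exact (measurable_const.mul ((measurable_stepFun _ _).comp (by fun_prop))).aestronglyMeasurable
    · exact (integrable_exp_neg_mul_sq (by linarith)).const_mul _
    · have hnn : 0 ≤ K * (C * Real.exp (b ^ 2 / (2 * c) + 2 * c)) * Real.exp (-(c / 4) * y ^ 2) := by
        positivity
      simp only [hΨ, stepFun_apply]
      rcases Nat.eq_zero_or_pos N with rfl | hNpos
      · simpa using hnn
      have hN := hNpos.ne'
      have hN' : (0 : ℝ) < N := by exact_mod_cast hNpos
      split_ifs with hu
      swap
      · simpa using hnn
      have hdist := abs_scaled_site_sub_le hN hu.1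
      set k := ⌊N * (1 + m) / 2 + √N / 2 * y⌋₊ with hk
      unfold windowMass
      split_ifs with hx
      swap
      · simpa using hnn
      obtain ⟨hk0, hkN⟩ := hkappa hN hx
      set x := site N k with hxdef
      have hs1 : 1 ≤ √(N : ℝ) := Real.one_le_sqrt.2 (by exact_mod_cast hNpos)
      have h2 : |√N * (x - m) - y| ≤ 2 := hdist.trans (div_le_self zero_le_two hs1)
      have hgx := hg N x (site_mem_Icc hN hkN.le)
      have hcoef : √N / 2 * stirlingCoeff N k ≤ K := by
        calc √N / 2 * stirlingCoeff N k
            ≤ √N / 2 * (Stirling.stirlingSeq 1 / Real.pi * √(N / (2 * k * (N - k : ℕ)))) := by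
              gcongr
              exact stirlingCoeff_le hk0 hkN
          _ = Stirling.stirlingSeq 1 / Real.pi * √(2 / (1 - x ^ 2)) / 2 := by
              rw [hxdef, ← sqrt_mul_sqrt_site hk0 hkN]; ring
          _ ≤ K := by
              have h3 : 1 - ρ ^ 2 ≤ 1 - x ^ 2 := by
                have := hwin _ hx
                have h4 : x ^ 2 ≤ ρ ^ 2 := sq_le_sq' (by linarith [abs_le.1 this]) (abs_le.1 this).2
                linarith
              have h5 : 0 < 1 - ρ ^ 2 := by nlinarith
              rw [hK]
              gcongr
      have hHx : N * (H p β h x - H p β h m) ≤ -(c * (√N * (x - m)) ^ 2) := by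
        have h3 := (abs_le.1 (hq (x - m) (hx.trans_le hrδ))).2
        rw [add_sub_cancel] at h3
        have h4 : H p β h x - H p β h m ≤ -(c * (x - m) ^ 2) := by
          have : curv p β m = -(4 * c) := by rw [hcdef]; ring
          rw [this] at h3
          linarith
        calc N * (H p β h x - H p β h m) ≤ N * -(c * (x - m) ^ 2) := by gcongr
          _ = -(c * (√N * (x - m)) ^ 2) := by rw [mul_pow, Real.sq_sqrt hN'.le]; ring
      have hmass : √N / 2 * (siteMass p β h N k * Real.exp (-(N * H p β h m)) * g N x)
          = (√N / 2 * stirlingCoeff N k) * Real.exp (N * (H p β h x - H p β h m)) * g N x := by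
        rw [siteMass_eq β h hk0 hkN, mul_sub, sub_eq_add_neg, Real.exp_add, ← hxdef]
        ring
      rw [hmass, Real.norm_eq_abs, abs_mul, abs_of_nonneg (by
        have := stirlingCoeff_nonneg N k
        positivity)]
      have habs : √N * |x - m| = |√N * (x - m)| := by
        rw [abs_mul, abs_of_nonneg (Real.sqrt_nonneg _)]
      have hexp := gaussian_exponent_le (b := b) hcpos h2
      calc _ ≤ K * Real.exp (-(c * (√N * (x - m)) ^ 2)) * (C * Real.exp (b * (√N * |x - m|))) := by
            have := stirlingCoeff_nonneg N k
            gcongr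
        _ = K * C * Real.exp (b * |√N * (x - m)| - c * (√N * (x - m)) ^ 2) := by
            rw [habs, sub_eq_neg_add (b * _), Real.exp_add]; ring
        _ ≤ K * C * Real.exp (b ^ 2 / (2 * c) + 2 * c + -(c / 4) * y ^ 2) := by gcongr
        _ = _ := by rw [Real.exp_add]; ring
    · filter_upwards [hf] with y hy
      set u : ℕ → ℝ := fun N => N * (1 + m) / 2 + √N / 2 * y with hudef
      set t : ℕ → ℝ := fun N => √N * (site N ⌊u N⌋₊ - m) with htdef
      have hw : Tendsto (fun N : ℕ => (1 + m) / 2 + y / 2 / √N) atTop (𝓝 ((1 + m) / 2)) := by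
        simpa using ((tendsto_const_nhds (x := y / 2)).div_atTop hsq).const_add ((1 + m) / 2)
      have hu01 : ∀ᶠ N : ℕ in atTop, 0 ≤ u N ∧ ⌊u N⌋₊ < N + 1 := by
        filter_upwards [hw.eventually (isOpen_Ioo.mem_nhds
          (⟨by linarith [hm.1], by linarith [hm.2]⟩ : (1 + m) / 2 ∈ Ioo (0 : ℝ) 1)),
          eventually_gt_atTop 0] with N h1 hN
        have hN' : (0 : ℝ) < N := by exact_mod_cast hN
        have e : u N = N * ((1 + m) / 2 + y / 2 / √N) := by
          have hss : (N : ℝ) / √N = √N := Real.div_sqrt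
          calc u N = N * ((1 + m) / 2) + √N * (y / 2) := by rw [hudef]; ring
            _ = N * ((1 + m) / 2) + (N / √N) * (y / 2) := by rw [hss]
            _ = _ := by ring
        have h0 : 0 ≤ u N := by rw [e]; exact mul_nonneg hN'.le h1.1.le
        refine ⟨h0, ?_⟩
        rw [Nat.floor_lt h0, e]
        push_cast
        nlinarith [h1.2]
      have ht : Tendsto t atTop (𝓝 y) := by
        rw [tendsto_iff_dist_tendsto_zero]
        refine squeeze_zero' (Eventually.of_forall fun _ => dist_nonneg) ?_
          ((tendsto_const_nhds (x := (2 : ℝ))).div_atTop hsq)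
        filter_upwards [hu01, eventually_ne_atTop 0] with N h1 hN
        exact abs_scaled_site_sub_le hN h1.1
      have hsite : ∀ᶠ N : ℕ in atTop, site N ⌊u N⌋₊ = m + t N / √N := by
        filter_upwards [eventually_ne_atTop 0] with N hN using site_eq_add_div hN _ _
      have hsm : Tendsto (fun N => site N ⌊u N⌋₊) atTop (𝓝 m) := by
        have : Tendsto (fun N => m + t N / √N) atTop (𝓝 m) := by
          simpa using (ht.div_atTop hsq).const_add m
        exact this.congr' (hsite.mono fun _ h => h.symm)
      have hlim := (tendsto_stirlingCoeff hm hsm).mul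
        ((Real.continuous_exp.continuousAt.tendsto.comp (tendsto_scaled_H hm hs ht)).mul (hy t ht))
      refine hlim.congr' ?_
      have hnear : ∀ᶠ N in atTop, |site N ⌊u N⌋₊ - m| < r := by
        filter_upwards [hsm.eventually (Metric.ball_mem_nhds m hr)] with N h1
        simpa [Real.dist_eq] using h1
      filter_upwards [hu01, hsite, hnear, eventually_ne_atTop 0] with N h1 h2 h3 hN
      obtain ⟨hk0, hkN⟩ := hkappa hN h3
      simp only [hΨ, stepFun_apply]
      rw [if_pos h1, windowMass, if_pos h3, siteMass_eq β h hk0 hkN]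
      simp only [Function.comp, ← h2]
      rw [mul_sub, sub_eq_add_neg, Real.exp_add]
      ring
  refine hΨint.congr' ?_
  filter_upwards [eventually_gt_atTop 0] with N hN
  have hN' : (0 : ℝ) < N := by exact_mod_cast hN
  exact integral_stepFun_affine _ _ _ (by positivity)

/-! ### Laplace asymptotics of the whole mass -/

/-- The unnormalized weight of a maximizer. -/
def peakWeight (p : ℕ) (β m : ℝ) : ℝ := ((m ^ 2 - 1) * curv p β m) ^ (-(1 / 2) : ℝ)

/-- The Gaussian law of the rescaled magnetization around a maximizer. -/
def peakLaw (p : ℕ) (β m : ℝ) : Measure ℝ := gaussianReal 0 (-curv p β m)⁻¹.toNNReal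

instance (p : ℕ) (β m : ℝ) : IsProbabilityMeasure (peakLaw p β m) := by
  unfold peakLaw; infer_instance

theorem peakWeight_pos {p : ℕ} {β m : ℝ} (hm : m ∈ Ioo (-1 : ℝ) 1) (hc : curv p β m < 0) :
    0 < peakWeight p β m :=
  Real.rpow_pos_of_pos (mul_pos_of_neg_of_neg (by nlinarith [hm.1, hm.2]) hc) _

/-- With `l = -H''(m)`, the constant splits as `√(2π(1 - m²)) = √((1 - m²)l) · √(2π/l)`: the inverse
weight times the Gaussian normalization. -/
theorem integral_eq_peakWeight_mul {p : ℕ} {β m : ℝ} (hm : m ∈ Ioo (-1 : ℝ) 1)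
    (hc : curv p β m < 0) (f : ℝ → ℝ) :
    ∫ y, 1 / √(2 * Real.pi * (1 - m ^ 2)) * (Real.exp (curv p β m / 2 * y ^ 2) * f y)
      = peakWeight p β m * ∫ y, f y ∂peakLaw p β m := by
  set l := -curv p β m with hl
  have hl0 : 0 < l := by linarith
  have hcl : curv p β m = -l := by rw [hl, neg_neg]
  have hv : (l⁻¹.toNNReal : ℝ≥0) ≠ 0 := by
    rw [Ne, Real.toNNReal_eq_zero, not_le]; positivity
  have hm2 : 0 < 1 - m ^ 2 := by nlinarith [hm.1, hm.2]
  rw [peakLaw, ← hl, integral_gaussianReal_eq_integral_smul hv, ← integral_const_mul]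
  congr 1
  ext y
  rw [gaussianPDFReal, Real.coe_toNNReal _ (by positivity), peakWeight, hcl,
    Real.rpow_neg (mul_nonneg_of_nonpos_of_nonpos (by linarith) (by linarith)),
    ← Real.sqrt_eq_rpow, smul_eq_mul]
  have e1 : (m ^ 2 - 1) * -l = (1 - m ^ 2) * l := by ring
  have e2 : -(y - 0) ^ 2 / (2 * l⁻¹) = -l / 2 * y ^ 2 := by field_simp; ring
  have e3 : √(2 * Real.pi * (1 - m ^ 2)) = √((1 - m ^ 2) * l) * √(2 * Real.pi * l⁻¹) := by
    rw [← Real.sqrt_mul (by positivity)]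
    congr 1
    field_simp
  rw [e1, e2, e3]
  have h1 : √((1 - m ^ 2) * l) ≠ 0 := (Real.sqrt_pos.2 (by positivity)).ne'
  have h2 : √(2 * Real.pi * l⁻¹) ≠ 0 := (Real.sqrt_pos.2 (by positivity)).ne'
  field_simp

/-- Away from the maximizers, `H` stays below its maximum. -/
theorem exists_gap {p : ℕ} {β h V r : ℝ} {M : Finset ℝ} (hM : (M : Set ℝ) = maximizers p β h)
    (hV : ∀ m ∈ M, H p β h m = V) (hr : 0 < r) :
    ∃ δ > 0, ∀ x ∈ Icc (-1 : ℝ) 1, (∀ m ∈ M, r ≤ |x - m|) → H p β h x ≤ V - δ := by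
  set K := Icc (-1 : ℝ) 1 ∩ ⋂ m ∈ M, {x : ℝ | r ≤ |x - m|} with hK
  have hKc : IsCompact K := isCompact_Icc.inter_right
    (isClosed_biInter fun m _ => isClosed_le continuous_const (by fun_prop))
  have hmem : ∀ x, x ∈ K ↔ x ∈ Icc (-1 : ℝ) 1 ∧ ∀ m ∈ M, r ≤ |x - m| := fun x => by
    simp [hK]
  obtain ⟨m₀, hm₀⟩ := nonempty_maximizers p β h
  rcases K.eq_empty_or_nonempty with he | hne
  -- No point is far from the maximizers, so any positive gap does.
  · refine ⟨1, one_pos, fun x hx hfar => ?_⟩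
    have : x ∈ K := (hmem x).2 ⟨hx, hfar⟩
    rw [he] at this
    exact this.elim
  · obtain ⟨x₀, hx₀, hmax⟩ := hKc.exists_isMaxOn hne (continuous_H p β h).continuousOn
    have hm₀M : m₀ ∈ M := by rw [← Finset.mem_coe, hM]; exact hm₀
    have hlt : H p β h x₀ < V := by
      rw [← hV m₀ hm₀M]
      refine lt_of_le_of_ne (hm₀.2 x₀ ((hmem x₀).1 hx₀).1) fun heq => ?_
      have hx₀M : x₀ ∈ M := by
        rw [← Finset.mem_coe, hM]
        exact ⟨((hmem x₀).1 hx₀).1, fun x hx => heq ▸ hm₀.2 x hx⟩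
      have := ((hmem x₀).1 hx₀).2 x₀ hx₀M
      rw [sub_self, abs_zero] at this
      linarith
    refine ⟨V - H p β h x₀, by linarith, fun x hx hfar => ?_⟩
    have : H p β h x ≤ H p β h x₀ := hmax ((hmem x).2 ⟨hx, hfar⟩)
    linarith

/-- Completing the square bounds `b√N` by `δN/2` plus a constant; the remaining exponential decay
beats the number of sites. -/
theorem tendsto_far_bound (A : ℝ) {b δ : ℝ} (hδ : 0 < δ) :
    Tendsto (fun N : ℕ => ((N : ℝ) + 1) * (A * Real.exp (b * √N - δ * N))) atTop (𝓝 0) := by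
  have hN : Tendsto (fun N : ℕ => δ / 2 * (N : ℝ)) atTop atTop :=
    tendsto_natCast_atTop_atTop.const_mul_atTop (by positivity)
  have h1 := (Real.tendsto_pow_mul_exp_neg_atTop_nhds_zero 1).comp hN
  have h0 := (Real.tendsto_pow_mul_exp_neg_atTop_nhds_zero 0).comp hN
  have h2 := ((h1.const_mul (2 / δ)).add h0).const_mul (|A| * Real.exp (b ^ 2 / (2 * δ)))
  simp only [mul_zero, add_zero] at h2
  refine squeeze_zero_norm (fun N => ?_) h2
  have hexp : b * √N - δ * N ≤ b ^ 2 / (2 * δ) + -(δ / 2 * N) := by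
    have h3 : 0 ≤ δ / 2 * (√N - b / δ) ^ 2 := by positivity
    have h4 : δ / 2 * (√N - b / δ) ^ 2 = δ / 2 * N - b * √N + b ^ 2 / (2 * δ) := by
      rw [sub_sq, Real.sq_sqrt (Nat.cast_nonneg N)]
      field_simp
    linarith
  simp only [Function.comp, pow_one, pow_zero, one_mul]
  rw [Real.norm_eq_abs, abs_mul, abs_mul, Real.abs_exp, abs_of_nonneg (by positivity)]
  calc ((N : ℝ) + 1) * (|A| * Real.exp (b * √N - δ * N))
      ≤ ((N : ℝ) + 1) * (|A| * Real.exp (b ^ 2 / (2 * δ) + -(δ / 2 * N))) := by gcongr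
    _ = _ := by
        rw [Real.exp_add]
        field_simp

/-- The mass of a test function, normalized by the exponential order `V` of the partition
function. -/
def scaledMass (p : ℕ) (β h V : ℝ) (N : ℕ) (g : ℝ → ℝ) : ℝ :=
  ∑ k ∈ Finset.range (N + 1), siteMass p β h N k * Real.exp (-(N * V)) * g (site N k)

/-- The sites split into disjoint windows around the maximizers, each with its own Laplace limit,
and a remainder made negligible by the gap of `H`. The growth allowed in the test functions admits
exponential tilts; convergence almost everywhere admits indicators. -/
theorem tendsto_scaledMass {p : ℕ} {β h V : ℝ} {M : Finset ℝ}
    (hM : (M : Set ℝ) = maximizers p β h) (hV : ∀ m ∈ M, H p β h m = V)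
    (hc : ∀ m ∈ M, curv p β m < 0) {g : ℕ → ℝ → ℝ} {f : ℝ → ℝ → ℝ} {C b : ℝ} (hC : 0 ≤ C)
    (hb : 0 ≤ b)
    (hg : ∀ m ∈ M, ∀ N, ∀ x ∈ Icc (-1 : ℝ) 1, |g N x| ≤ C * Real.exp (b * (√N * |x - m|)))
    (hf : ∀ m ∈ M, ∀ᵐ y, ∀ t : ℕ → ℝ, Tendsto t atTop (𝓝 y) →
        Tendsto (fun N => g N (m + t N / √N)) atTop (𝓝 (f m y))) :
    Tendsto (fun N => scaledMass p β h V N (g N)) atTop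
      (𝓝 (∑ m ∈ M, peakWeight p β m * ∫ y, f m y ∂peakLaw p β m)) := by
  have hmax : ∀ m ∈ M, m ∈ maximizers p β h := fun m hm => by rw [← hM]; exact hm
  have hIoo : ∀ m ∈ M, m ∈ Ioo (-1 : ℝ) 1 := fun m hm => mem_Ioo_of_mem_maximizers (hmax m hm)
  have hwin := fun m : M => tendsto_sum_windowMass (p := p) (β := β) (h := h) (hIoo m.1 m.2)
    (slope_eq_zero_of_mem_maximizers (hmax m.1 m.2)) (hc m.1 m.2)
  choose r₀ hr₀ hw using hwin
  -- A radius at most half the separation of the maximizers makes the windows disjoint.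
  obtain ⟨r, hr, hrr, hrsep⟩ : ∃ r > 0, (∀ m : M, r ≤ r₀ m) ∧
      ∀ m : M, ∀ m' : M, m ≠ m' → 2 * r ≤ |(m : ℝ) - m'| := by
    have h1 : ∀ᶠ r in 𝓝[>] (0 : ℝ), ∀ m : M, r ≤ r₀ m :=
      eventually_all.2 fun m => mem_of_superset (Ioc_mem_nhdsGT (hr₀ m)) fun _ h => h.2
    have h2 : ∀ᶠ r in 𝓝[>] (0 : ℝ), ∀ m : M, ∀ m' : M, m ≠ m' → 2 * r ≤ |(m : ℝ) - m'| := by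
      refine eventually_all.2 fun m => eventually_all.2 fun m' => ?_
      by_cases hne : m = m'
      · exact Eventually.of_forall fun _ h => (h hne).elim
      · have : 0 < |(m : ℝ) - m'| / 2 := by
          have : (m : ℝ) - m' ≠ 0 := sub_ne_zero.2 fun h => hne (Subtype.ext h)
          positivity
        filter_upwards [Ioc_mem_nhdsGT this] with r hr _
        linarith [hr.2]
    obtain ⟨r, ⟨h1, h2⟩, h3⟩ := ((h1.and h2).and self_mem_nhdsWithin).exists
    exact ⟨r, h3, h1, h2⟩
  obtain ⟨δ, hδ, hgap⟩ := exists_gap hM hV hr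
  set far : ℕ → ℕ → ℝ := fun N k => if ∃ m ∈ M, |site N k - m| < r then 0 else
    siteMass p β h N k * Real.exp (-(N * V)) * g N (site N k) with hfar
  have hdecomp : ∀ N k, siteMass p β h N k * Real.exp (-(N * V)) * g N (site N k)
      = ∑ m ∈ M, windowMass p β h m r g N k + far N k := by
    intro N k
    simp only [hfar]
    split_ifs with hex
    · obtain ⟨m, hm, hlt⟩ := hex
      rw [Finset.sum_eq_single_of_mem m hm, windowMass, if_pos hlt, hV m hm, add_zero]
      intro m' hm' hne
      rw [windowMass, if_neg]
      intro hlt'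
      have h1 := hrsep ⟨m, hm⟩ ⟨m', hm'⟩ fun h => hne (Subtype.ext_iff.1 h).symm
      have h2 := abs_sub_le m (site N k) m'
      rw [abs_sub_comm m (site N k)] at h2
      simp only at h1
      linarith
    · rw [Finset.sum_eq_zero, zero_add]
      intro m hm
      rw [windowMass, if_neg fun h => hex ⟨m, hm, h⟩]
  have hwlim : Tendsto (fun N => ∑ m ∈ M, ∑ k ∈ Finset.range (N + 1), windowMass p β h m r g N k)
      atTop (𝓝 (∑ m ∈ M, peakWeight p β m * ∫ y, f m y ∂peakLaw p β m)) := by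
    refine tendsto_finsetSum _ fun m hm => ?_
    rw [← integral_eq_peakWeight_mul (hIoo m hm) (hc m hm)]
    exact hw ⟨m, hm⟩ r hr (hrr ⟨m, hm⟩) g (f m) C b hC (hg m hm) (hf m hm)
  have hflim : Tendsto (fun N => ∑ k ∈ Finset.range (N + 1), far N k) atTop (𝓝 0) := by
    obtain ⟨m₀, hm₀⟩ := nonempty_maximizers p β h
    have hm₀M : m₀ ∈ M := by rw [← Finset.mem_coe, hM]; exact hm₀
    set A := (Stirling.stirlingSeq 1 / Real.pi + 1) * C with hA
    have hS : 0 ≤ Stirling.stirlingSeq 1 / Real.pi + 1 := by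
      have := div_nonneg (stirlingSeq_pos one_ne_zero).le Real.pi_pos.le
      linarith
    have hA0 : 0 ≤ A := mul_nonneg hS hC
    -- The doubling of `b` comes from `|x - m₀| ≤ 2` on `[-1, 1]`.
    refine squeeze_zero_norm' ?_ (tendsto_far_bound A (b := 2 * b) hδ)
    filter_upwards [eventually_ne_atTop 0] with N hN
    have hterm : ∀ k ∈ Finset.range (N + 1), ‖far N k‖ ≤ A * Real.exp (2 * b * √N - δ * N) := by
      intro k hk
      have hkN : k ≤ N := Nat.lt_succ_iff.1 (Finset.mem_range.1 hk)
      have hx := site_mem_Icc hN hkN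
      simp only [hfar]
      split_ifs with hex
      · rw [norm_zero]; positivity
      · push Not at hex
        have hH := hgap _ hx hex
        have h1 := hg m₀ hm₀M N _ hx
        have h2 : |site N k - m₀| ≤ 2 := by
          rw [abs_le]
          constructor <;> linarith [hx.1, hx.2, hm₀.1.1, hm₀.1.2]
        rw [Real.norm_eq_abs, abs_mul, abs_mul, Real.abs_exp,
          abs_of_nonneg (siteMass_nonneg p β h N k)]
        calc _ ≤ (Stirling.stirlingSeq 1 / Real.pi + 1) * Real.exp (N * (V - δ)) *
              Real.exp (-(N * V)) * (C * Real.exp (b * (√N * 2))) := by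
              gcongr
              · exact (siteMass_le β h hN hkN).trans (by gcongr)
              · exact h1.trans (by gcongr)
          _ = A * (Real.exp (N * (V - δ)) * Real.exp (-(N * V)) * Real.exp (b * (√N * 2))) := by
              rw [hA]; ring
          _ = _ := by
              rw [← Real.exp_add, ← Real.exp_add]
              congr 2
              ring
    calc _ ≤ ∑ k ∈ Finset.range (N + 1), ‖far N k‖ := norm_sum_le _ _
      _ ≤ ∑ _k ∈ Finset.range (N + 1), A * Real.exp (2 * b * √N - δ * N) :=
          Finset.sum_le_sum hterm
      _ = _ := by simp
  have := hwlim.add hflim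
  rw [add_zero] at this
  refine this.congr fun N => ?_
  rw [Finset.sum_comm, ← Finset.sum_add_distrib]
  exact Finset.sum_congr rfl fun k _ => (hdecomp N k).symm

/-! ### Limits of expectations of functions of the magnetization -/

/-- The expectation of a function of the magnetization. -/
def expect (p : ℕ) (β h : ℝ) (N : ℕ) (g : ℝ → ℝ) : ℝ :=
  ∑ x : SpinConfig N, likelihood p β h x * g (mag x)

/-- The asymptotic probability of a maximizer. -/
def peakProb (p : ℕ) (β : ℝ) (M : Finset ℝ) (m : ℝ) : ℝ :=
  peakWeight p β m / ∑ i ∈ M, peakWeight p β i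

theorem law_real_eq (p : ℕ) (β h : ℝ) {N : ℕ} (S : Set (SpinConfig N)) :
    (law p β h N).real S = ∑ x, likelihood p β h x * S.indicator (fun _ => 1) x := by
  classical
  rw [Measure.real, law, Measure.coe_finsetSum, Finset.sum_apply, ENNReal.toReal_sum]
  · refine Finset.sum_congr rfl fun x _ => ?_
    rw [Measure.smul_apply, Measure.dirac_apply, smul_eq_mul, ENNReal.toReal_mul,
      ENNReal.toReal_ofReal (likelihood_nonneg p β h x)]
    by_cases hx : x ∈ S <;> simp [hx]
  · intro x _
    rw [Measure.smul_apply, smul_eq_mul]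
    exact ENNReal.mul_ne_top ENNReal.ofReal_ne_top (measure_ne_top _ _)

/-- A union bound. In its use `B` is `{1, -1}`, the magnetizations for which the estimator is
arbitrary. -/
theorem law_real_le_expect_add {p : ℕ} {β h : ℝ} {N : ℕ} {S : Set (SpinConfig N)} {A B : Set ℝ}
    (hS : ∀ x ∈ S, mag x ∈ A ∨ mag x ∈ B) :
    (law p β h N).real S ≤ expect p β h N (A.indicator fun _ => 1)
      + expect p β h N (B.indicator fun _ => 1) := by
  rw [law_real_eq, expect, expect, ← Finset.sum_add_distrib]
  refine Finset.sum_le_sum fun x _ => ?_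
  rw [← mul_add]
  refine mul_le_mul_of_nonneg_left ?_ (likelihood_nonneg p β h x)
  have hA : 0 ≤ A.indicator (fun _ => (1 : ℝ)) (mag x) := indicator_nonneg (by simp) _
  have hB : 0 ≤ B.indicator (fun _ => (1 : ℝ)) (mag x) := indicator_nonneg (by simp) _
  by_cases hx : x ∈ S
  · rw [indicator_of_mem hx]
    rcases hS x hx with h | h
    · rw [indicator_of_mem h]; linarith
    · rw [indicator_of_mem h]; linarith
  · rw [indicator_of_notMem hx]; linarith

theorem expect_le_law_real_add {p : ℕ} {β h : ℝ} {N : ℕ} {S : Set (SpinConfig N)} {A B : Set ℝ}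
    (hS : ∀ x, mag x ∈ A → x ∈ S ∨ mag x ∈ B) :
    expect p β h N (A.indicator fun _ => 1) ≤
      (law p β h N).real S + expect p β h N (B.indicator fun _ => 1) := by
  rw [law_real_eq, expect, expect, ← Finset.sum_add_distrib]
  refine Finset.sum_le_sum fun x _ => ?_
  rw [← mul_add]
  refine mul_le_mul_of_nonneg_left ?_ (likelihood_nonneg p β h x)
  have hA : 0 ≤ S.indicator (fun _ => (1 : ℝ)) x := indicator_nonneg (by simp) _
  have hB : 0 ≤ B.indicator (fun _ => (1 : ℝ)) (mag x) := indicator_nonneg (by simp) _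
  by_cases hx : mag x ∈ A
  · rw [indicator_of_mem hx]
    rcases hS x hx with h | h
    · rw [indicator_of_mem h]; linarith
    · rw [indicator_of_mem h]; linarith
  · rw [indicator_of_notMem hx]; linarith

theorem expect_eq_div {p : ℕ} (hp : 1 ≤ p) (β h V : ℝ) {N : ℕ} (hN : N ≠ 0) (g : ℝ → ℝ) :
    expect p β h N g = scaledMass p β h V N g / scaledMass p β h V N fun _ => 1 := by
  rw [expect, sum_likelihood_mul hp β h hN]
  simp only [scaledMass, mul_right_comm _ (Real.exp (-(N * V))), ← Finset.sum_mul, mul_one]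
  rw [mul_div_mul_right _ _ (Real.exp_pos _).ne']

/-- The standing assumptions on the finite set of maximizers. -/
structure IsPeakSet (p : ℕ) (β h : ℝ) (M : Finset ℝ) : Prop where
  one_le : 1 ≤ p
  coe_eq : (M : Set ℝ) = maximizers p β h
  curv_neg : ∀ m ∈ M, curv p β m < 0

namespace IsPeakSet

variable {p : ℕ} {β h : ℝ} {M : Finset ℝ}

theorem mem_maximizers (hM : IsPeakSet p β h M) {m : ℝ} (hm : m ∈ M) : m ∈ maximizers p β h := by
  rw [← hM.coe_eq]; exact hm

theorem mem_Ioo (hM : IsPeakSet p β h M) {m : ℝ} (hm : m ∈ M) : m ∈ Ioo (-1 : ℝ) 1 :=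
  mem_Ioo_of_mem_maximizers (hM.mem_maximizers hm)

theorem peakWeight_pos (hM : IsPeakSet p β h M) {m : ℝ} (hm : m ∈ M) : 0 < peakWeight p β m :=
  CurieWeiss.peakWeight_pos (hM.mem_Ioo hm) (hM.curv_neg m hm)

theorem nonempty (hM : IsPeakSet p β h M) : M.Nonempty := by
  rw [← Finset.coe_nonempty, hM.coe_eq]
  exact nonempty_maximizers p β h

theorem sum_peakWeight_pos (hM : IsPeakSet p β h M) : 0 < ∑ i ∈ M, peakWeight p β i :=
  Finset.sum_pos (fun _ hm => hM.peakWeight_pos hm) hM.nonempty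

theorem peakProb_pos (hM : IsPeakSet p β h M) {m : ℝ} (hm : m ∈ M) : 0 < peakProb p β M m :=
  div_pos (hM.peakWeight_pos hm) hM.sum_peakWeight_pos

/-- The expectation is a ratio of scaled masses, and the test function `1` in the denominator yields
the sum of the peak weights. -/
theorem tendsto_expect (hM : IsPeakSet p β h M) {g : ℕ → ℝ → ℝ} {f : ℝ → ℝ → ℝ} {b : ℝ}
    (hb : 0 ≤ b)
    (hg : ∀ m ∈ M, ∀ N, ∀ x ∈ Icc (-1 : ℝ) 1, |g N x| ≤ Real.exp (b * (√N * |x - m|)))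
    (hf : ∀ m ∈ M, ∀ᵐ y, ∀ t : ℕ → ℝ, Tendsto t atTop (𝓝 y) →
        Tendsto (fun N => g N (m + t N / √N)) atTop (𝓝 (f m y))) :
    Tendsto (fun N => expect p β h N (g N)) atTop
      (𝓝 (∑ m ∈ M, peakProb p β M m * ∫ y, f m y ∂peakLaw p β m)) := by
  obtain ⟨m₀, hm₀⟩ := hM.nonempty
  have hV : ∀ m ∈ M, H p β h m = H p β h m₀ := fun m hm =>
    H_eq_of_mem_maximizers (hM.mem_maximizers hm) (hM.mem_maximizers hm₀)
  have h1 := tendsto_scaledMass hM.coe_eq hV hM.curv_neg zero_le_one hb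
    (by simpa only [one_mul] using hg) hf
  have h2 := tendsto_scaledMass (g := fun _ _ => 1) (f := fun _ _ => 1) hM.coe_eq hV hM.curv_neg
    zero_le_one le_rfl (by simp) (fun m _ => Eventually.of_forall fun y t _ => tendsto_const_nhds)
  simp only [integral_const, probReal_univ, smul_eq_mul, mul_one] at h2
  have h3 := h1.div h2 hM.sum_peakWeight_pos.ne'
  have e : ∑ m ∈ M, peakProb p β M m * ∫ y, f m y ∂peakLaw p β m
      = (∑ m ∈ M, peakWeight p β m * ∫ y, f m y ∂peakLaw p β m) / ∑ m ∈ M, peakWeight p β m := by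
    rw [Finset.sum_div]
    exact Finset.sum_congr rfl fun m _ => by rw [peakProb]; ring
  rw [e]
  refine h3.congr' ?_
  filter_upwards [eventually_ne_atTop 0] with N hN
  exact (expect_eq_div hM.one_le β h _ hN _).symm

theorem sqrt_mul_shift {N : ℕ} (hN : N ≠ 0) (m e t : ℝ) :
    √(N : ℝ) * (m + t / √N - e) = t + √N * (m - e) := by
  have hN' : (0 : ℝ) < N := by exact_mod_cast Nat.pos_of_ne_zero hN
  have hs : 0 < √(N : ℝ) := Real.sqrt_pos.2 hN'
  field_simp
  ring

/-- Exponential moments around an extremal maximizer. -/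
theorem tendsto_expect_exp (hM : IsPeakSet p β h M) {e s : ℝ} (he : e ∈ M)
    (hs : ∀ m ∈ M, m ≠ e → s * (m - e) < 0) :
    Tendsto (fun N => expect p β h N fun x => Real.exp (s * (√N * (x - e)))) atTop
      (𝓝 (peakProb p β M e * Real.exp (s ^ 2 / (2 * -curv p β e)))) := by
  have hsq : Tendsto (fun N : ℕ => √(N : ℝ)) atTop atTop :=
    Real.tendsto_sqrt_atTop.comp tendsto_natCast_atTop_atTop
  -- Around `m ≠ e` the exponent contains `√N s(m - e)`, which tends to `-∞`, so only the peak at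
  -- `e` survives. The same sign gives the domination.
  have hmain := hM.tendsto_expect (g := fun N x => Real.exp (s * (√N * (x - e))))
    (f := fun m y => if m = e then Real.exp (s * y) else 0) (abs_nonneg s) ?_ ?_
  · have hval : ∑ m ∈ M, peakProb p β M m *
        ∫ y, (if m = e then Real.exp (s * y) else 0) ∂peakLaw p β m
        = peakProb p β M e * Real.exp (s ^ 2 / (2 * -curv p β e)) := by
      rw [Finset.sum_eq_single_of_mem e he fun m _ hne => by simp [hne]]
      simp only [if_true]
      have hmgf := congrFun (mgf_id_gaussianReal (μ := 0) (v := (-curv p β e)⁻¹.toNNReal)) s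
      simp only [mgf, id] at hmgf
      have hc := hM.curv_neg e he
      rw [peakLaw, hmgf, Real.coe_toNNReal _ (inv_nonneg.2 (by linarith))]
      congr 2
      have : -curv p β e ≠ 0 := by linarith
      field_simp
      ring
    rwa [hval] at hmain
  · intro m hm N x _
    rw [Real.abs_exp, Real.exp_le_exp]
    have h1 : s * (m - e) ≤ 0 := by
      by_cases hne : m = e
      · simp [hne]
      · exact (hs m hm hne).le
    have h2 : s * (x - m) ≤ |s| * |x - m| := by rw [← abs_mul]; exact le_abs_self _
    calc s * (√N * (x - e)) = √N * (s * (x - m) + s * (m - e)) := by ring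
      _ ≤ √N * (|s| * |x - m|) := by gcongr; linarith
      _ = |s| * (√N * |x - m|) := by ring
  · intro m hm
    refine Eventually.of_forall fun y t ht => ?_
    have hcongr : (fun N : ℕ => Real.exp (s * t N + √N * (s * (m - e)))) =ᶠ[atTop]
        fun N => Real.exp (s * (√N * (m + t N / √N - e))) := by
      filter_upwards [eventually_ne_atTop 0] with N hN
      rw [sqrt_mul_shift hN]
      ring_nf
    refine Tendsto.congr' hcongr ?_
    by_cases hne : m = e
    · simp only [hne, sub_self, mul_zero, add_zero, if_true]
      exact (Real.continuous_exp.tendsto _).comp (ht.const_mul s)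
    · simp only [if_neg hne]
      exact Real.tendsto_exp_atBot.comp
        ((ht.const_mul s).add_atBot (hsq.atTop_mul_const_of_neg (hs m hm hne)))

theorem peakLaw_nullSingletonClass (hM : IsPeakSet p β h M) {e : ℝ} (he : e ∈ M) :
    NullSingletonClass (peakLaw p β e) := by
  unfold peakLaw
  refine nullSingletonClass_gaussianReal ?_
  rw [Ne, Real.toNNReal_eq_zero, not_le, inv_pos]
  linarith [hM.curv_neg e he]

/-- The limiting distribution function of the magnetization rescaled around `e`. -/
def limitCDF (p : ℕ) (β : ℝ) (M : Finset ℝ) (e c : ℝ) : ℝ :=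
  ∑ m ∈ M with m < e, peakProb p β M m + peakProb p β M e * (peakLaw p β e).real (Iic c)

/-- Peaks to the left of `e` count fully and those to the right not at all. The moving threshold `u
N` is harmless because the indicators converge at every `y ≠ c`. -/
theorem tendsto_expect_Iic (hM : IsPeakSet p β h M) {e c : ℝ} (he : e ∈ M) {u : ℕ → ℝ}
    (hu : Tendsto u atTop (𝓝 c)) :
    Tendsto (fun N => expect p β h N ({x | √N * (x - e) ≤ u N}.indicator fun _ => 1)) atTop
      (𝓝 (limitCDF p β M e c)) := by
  have hsq : Tendsto (fun N : ℕ => √(N : ℝ)) atTop atTop :=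
    Real.tendsto_sqrt_atTop.comp tendsto_natCast_atTop_atTop
  have hmain := hM.tendsto_expect (g := fun N => {x | √N * (x - e) ≤ u N}.indicator fun _ => 1)
    (f := fun m y => if m < e then 1 else if m = e then (Iic c).indicator (fun _ => 1) y else 0)
    le_rfl ?_ ?_
  · have hval : ∑ m ∈ M, peakProb p β M m *
        ∫ y, (if m < e then 1 else if m = e then (Iic c).indicator (fun _ => (1 : ℝ)) y else 0)
          ∂peakLaw p β m = limitCDF p β M e c := by
      rw [limitCDF, Finset.sum_filter]
      have hsingle : peakProb p β M e * (peakLaw p β e).real (Iic c)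
          = ∑ m ∈ M, if m = e then peakProb p β M e * (peakLaw p β e).real (Iic c) else 0 := by
        rw [Finset.sum_ite_eq' M e, if_pos he]
      rw [hsingle, ← Finset.sum_add_distrib]
      refine Finset.sum_congr rfl fun m _ => ?_
      rcases lt_trichotomy m e with h | h | h
      · simp [h, h.ne]
      · subst h
        simp [integral_indicator_const]
      · simp [h.not_gt, h.ne']
    rwa [hval] at hmain
  · intro m _ N x _
    rw [zero_mul, Real.exp_zero]
    by_cases hx : x ∈ {x | √(N : ℝ) * (x - e) ≤ u N}
    · simp [indicator_of_mem hx]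
    · simp [indicator_of_notMem hx]
  · intro m _
    have hshift : ∀ t : ℕ → ℝ, ∀ᶠ N : ℕ in atTop,
        ((m + t N / √N) ∈ {x | √(N : ℝ) * (x - e) ≤ u N} ↔ t N + √N * (m - e) ≤ u N) := by
      intro t
      filter_upwards [eventually_ne_atTop 0] with N hN
      rw [sqrt_mul_shift hN]
    have hone : ∀ t : ℕ → ℝ, (∀ᶠ N : ℕ in atTop, t N + √N * (m - e) ≤ u N) →
        Tendsto (fun N : ℕ => {x | √(N : ℝ) * (x - e) ≤ u N}.indicator (fun _ => (1 : ℝ))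
          (m + t N / √N)) atTop (𝓝 1) := fun t h => by
      refine tendsto_const_nhds.congr' ?_
      filter_upwards [h, hshift t] with N h1 h2
      exact (indicator_of_mem (M := ℝ) (s := {x | √(N : ℝ) * (x - e) ≤ u N}) (h2.2 h1) fun _ => 1).symm
    have hzero : ∀ t : ℕ → ℝ, (∀ᶠ N : ℕ in atTop, ¬ t N + √N * (m - e) ≤ u N) →
        Tendsto (fun N : ℕ => {x | √(N : ℝ) * (x - e) ≤ u N}.indicator (fun _ => (1 : ℝ))
          (m + t N / √N)) atTop (𝓝 0) := fun t h => by
      refine tendsto_const_nhds.congr' ?_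
      filter_upwards [h, hshift t] with N h1 h2
      exact (indicator_of_notMem (M := ℝ) (s := {x | √(N : ℝ) * (x - e) ≤ u N})
        (fun h => h1 (h2.1 h)) fun _ => 1).symm
    have hne : ∀ᵐ y : ℝ, y ≠ c := by simp [ae_iff]
    filter_upwards [hne] with y hy t ht
    rcases lt_trichotomy m e with hlt | heq | hgt
    · simp only [if_pos hlt]
      refine hone t ?_
      have h1 : Tendsto (fun N : ℕ => (t N - u N) + √N * (m - e)) atTop atBot :=
        (ht.sub hu).add_atBot (hsq.atTop_mul_const_of_neg (by linarith))
      filter_upwards [h1.eventually_le_atBot 0] with N h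
      linarith
    · simp only [heq, lt_irrefl, if_false, if_true]
      rw [heq] at hone hzero
      rcases lt_or_gt_of_ne hy with h | h
      · rw [indicator_of_mem (show y ∈ Iic c from h.le)]
        refine hone t ?_
        filter_upwards [ht.eventually_lt hu h] with N hN
        rw [sub_self, mul_zero, add_zero]
        exact hN.le
      · rw [indicator_of_notMem (show y ∉ Iic c from not_le.2 h)]
        refine hzero t ?_
        filter_upwards [hu.eventually_lt ht h] with N hN
        rw [sub_self, mul_zero, add_zero]
        exact not_le.2 hN
    · simp only [if_neg hgt.not_gt, if_neg hgt.ne']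
      refine hzero t ?_
      have h1 : Tendsto (fun N : ℕ => (t N - u N) + √N * (m - e)) atTop atTop :=
        (ht.sub hu).add_atTop (hsq.atTop_mul_const (by linarith))
      filter_upwards [h1.eventually_gt_atTop 0] with N h
      rw [not_le]
      linarith

/-- Every maximizer is interior, so the configurations without a maximum likelihood estimator are
negligible. -/
theorem tendsto_expect_boundary (hM : IsPeakSet p β h M) :
    Tendsto (fun N => expect p β h N (({1, -1} : Set ℝ).indicator fun _ => 1)) atTop (𝓝 0) := by
  have hsq : Tendsto (fun N : ℕ => √(N : ℝ)) atTop atTop :=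
    Real.tendsto_sqrt_atTop.comp tendsto_natCast_atTop_atTop
  have hmain := hM.tendsto_expect (g := fun _ => ({1, -1} : Set ℝ).indicator fun _ => 1)
    (f := fun _ _ => 0) le_rfl ?_ ?_
  · simpa using hmain
  · intro m _ N x _
    rw [zero_mul, Real.exp_zero]
    by_cases hx : x ∈ ({1, -1} : Set ℝ)
    · simp [indicator_of_mem hx]
    · simp [indicator_of_notMem hx]
  · intro m hm
    refine Eventually.of_forall fun y t ht => ?_
    have h1 : Tendsto (fun N : ℕ => m + t N / √N) atTop (𝓝 m) := by
      simpa using (ht.div_atTop hsq).const_add m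
    refine tendsto_const_nhds.congr' ?_
    filter_upwards [h1.eventually (isOpen_Ioo.mem_nhds (hM.mem_Ioo hm))] with N hN
    rw [indicator_of_notMem]
    rintro (h | h)
    · exact hN.2.ne h
    · exact hN.1.ne' h

theorem continuous_limitCDF (hM : IsPeakSet p β h M) {e : ℝ} (he : e ∈ M) :
    Continuous (limitCDF p β M e) := by
  have := hM.peakLaw_nullSingletonClass he
  unfold limitCDF
  refine continuous_const.add (continuous_const.mul ?_)
  have hint : ∀ c, (peakLaw p β e).real (Iic c)
      = ∫ y, (Iic c).indicator (fun _ => (1 : ℝ)) y ∂peakLaw p β e := fun c => by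
    rw [integral_indicator_const _ measurableSet_Iic, smul_eq_mul, mul_one]
  simp only [hint]
  rw [continuous_iff_continuousAt]
  intro c
  refine continuousAt_of_dominated (bound := fun _ => 1)
    (Eventually.of_forall fun x => (measurable_const.indicator measurableSet_Iic).aestronglyMeasurable)
    (Eventually.of_forall fun x => Eventually.of_forall fun y => ?_) (integrable_const _) ?_
  · by_cases hy : y ∈ Iic x
    · simp [indicator_of_mem hy]
    · simp [indicator_of_notMem hy]
  · have hne : ∀ᵐ y ∂peakLaw p β e, y ≠ c := by
      simp [ae_iff]
    filter_upwards [hne] with y hy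
    rcases lt_or_gt_of_ne hy with h | h
    · refine (continuousAt_const (y := (1 : ℝ))).congr ?_
      filter_upwards [lt_mem_nhds h] with x hx
      rw [indicator_of_mem (show y ∈ Iic x from le_of_lt hx)]
    · refine (continuousAt_const (y := (0 : ℝ))).congr ?_
      filter_upwards [gt_mem_nhds h] with x hx
      rw [indicator_of_notMem (show y ∉ Iic x from not_le.2 hx)]

end IsPeakSet

/-! ### The maximum likelihood estimator -/

/-- The inverse likelihood of `x`, a convex function of the field. -/
def invLikelihood (p : ℕ) (β : ℝ) {N : ℕ} (x : SpinConfig N) (h : ℝ) : ℝ :=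
  ∑ x' : SpinConfig N, Real.exp (exponent p β h x' - exponent p β h x)

theorem invLikelihood_pos (p : ℕ) (β : ℝ) {N : ℕ} (x : SpinConfig N) (h : ℝ) :
    0 < invLikelihood p β x h :=
  Finset.sum_pos (fun _ _ => Real.exp_pos _) Finset.univ_nonempty

theorem likelihood_eq_inv (p : ℕ) (β : ℝ) {N : ℕ} (x : SpinConfig N) (h : ℝ) :
    likelihood p β h x = (invLikelihood p β x h)⁻¹ := by
  have h3 : (2 : ℝ) ^ N * partitionFunction p β h N
      = ∑ x : SpinConfig N, Real.exp (exponent p β h x) := by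
    unfold partitionFunction
    field_simp
  rw [likelihood, h3, invLikelihood]
  simp only [Real.exp_sub, ← Finset.sum_div]
  rw [inv_div]

theorem likelihood_le_iff (p : ℕ) (β : ℝ) {N : ℕ} (x : SpinConfig N) (h h' : ℝ) :
    likelihood p β h x ≤ likelihood p β h' x ↔ invLikelihood p β x h' ≤ invLikelihood p β x h := by
  rw [likelihood_eq_inv, likelihood_eq_inv,
    inv_le_inv₀ (invLikelihood_pos p β x h) (invLikelihood_pos p β x h')]

theorem exponent_sub_exponent {p : ℕ} (β h : ℝ) {N : ℕ} (x x' : SpinConfig N) :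
    exponent p β h x' - exponent p β h x
      = (exponent p β 0 x' - exponent p β 0 x) + (∑ i, spin x' i - ∑ i, spin x i) * h := by
  simp only [exponent]
  ring

/-- Each summand is the exponential of an affine function of the field. -/
theorem convexOn_invLikelihood (p : ℕ) (β : ℝ) {N : ℕ} (x : SpinConfig N) :
    ConvexOn ℝ univ (invLikelihood p β x) := by
  refine ⟨convex_univ, fun s _ t _ a b ha hb hab => ?_⟩
  simp only [invLikelihood, smul_eq_mul, Finset.mul_sum, ← Finset.sum_add_distrib]
  refine Finset.sum_le_sum fun x' _ => ?_
  have h1 := convexOn_exp.2 (mem_univ (exponent p β s x' - exponent p β s x))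
    (mem_univ (exponent p β t x' - exponent p β t x)) ha hb hab
  simp only [smul_eq_mul] at h1
  convert h1 using 2
  rw [exponent_sub_exponent, exponent_sub_exponent β s, exponent_sub_exponent β t]
  linear_combination -(exponent p β 0 x' - exponent p β 0 x) * hab

theorem continuous_invLikelihood (p : ℕ) (β : ℝ) {N : ℕ} (x : SpinConfig N) :
    Continuous (invLikelihood p β x) := by
  unfold invLikelihood exponent
  fun_prop

theorem exp_le_invLikelihood (p : ℕ) (β h : ℝ) {N : ℕ} (x x' : SpinConfig N) :
    Real.exp (exponent p β h x' - exponent p β h x) ≤ invLikelihood p β x h :=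
  Finset.single_le_sum (f := fun x' => Real.exp (exponent p β h x' - exponent p β h x))
    (fun _ _ => (Real.exp_pos _).le) (Finset.mem_univ x')

/-- Coercivity: unless all spins of `x` agree, the all-minus term blows up as the field tends to
`-∞` and the all-plus term as it tends to `+∞`. -/
theorem exists_forall_invLikelihood_le (p : ℕ) (β : ℝ) {N : ℕ} (hN : N ≠ 0) {x : SpinConfig N}
    (hx : mag x ∈ Ioo (-1 : ℝ) 1) :
    ∃ h₀, ∀ h, invLikelihood p β x h₀ ≤ invLikelihood p β x h := by
  refine (continuous_invLikelihood p β x).exists_forall_le ?_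
  have hN' : (0 : ℝ) < N := by exact_mod_cast Nat.pos_of_ne_zero hN
  have hsum : ∑ i, spin x i = N * mag x := by rw [mag]; field_simp
  rw [cocompact_eq_atBot_atTop, tendsto_sup]
  constructor
  · have hs : ∑ i, spin (fun _ => -1 : SpinConfig N) i = -(N : ℝ) := by simp [spin]
    refine tendsto_atTop_mono (fun h => exp_le_invLikelihood p β h x (fun _ => -1)) ?_
    refine (tendsto_congr fun h => congrArg Real.exp (exponent_sub_exponent β h x _)).2 ?_
    refine Real.tendsto_exp_atTop.comp (tendsto_atTop_add_const_left _ _ ?_)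
    refine tendsto_id.const_mul_atBot_of_neg ?_
    rw [hs, hsum]
    nlinarith [hx.1]
  · have hs : ∑ i, spin (fun _ => 1 : SpinConfig N) i = (N : ℝ) := by simp [spin]
    refine tendsto_atTop_mono (fun h => exp_le_invLikelihood p β h x (fun _ => 1)) ?_
    refine (tendsto_congr fun h => congrArg Real.exp (exponent_sub_exponent β h x _)).2 ?_
    refine Real.tendsto_exp_atTop.comp (tendsto_atTop_add_const_left _ _ ?_)
    refine tendsto_id.const_mul_atTop ?_
    rw [hs, hsum]
    nlinarith [hx.2]

theorem IsMLE.invLikelihood_le {p : ℕ} {β : ℝ} {N : ℕ} {hhat : SpinConfig N → ℝ}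
    (hmle : IsMLE p β hhat) (hN : N ≠ 0) {x : SpinConfig N} (hx : mag x ∈ Ioo (-1 : ℝ) 1) (h : ℝ) :
    invLikelihood p β x (hhat x) ≤ invLikelihood p β x h := by
  obtain ⟨h₀, hh₀⟩ := exists_forall_invLikelihood_le p β hN hx
  exact (likelihood_le_iff p β x _ _).1
    (hmle x ⟨h₀, fun h' => (likelihood_le_iff p β x _ _).2 (hh₀ h')⟩ h)

/-- The moment generating function of the magnetization rescaled around `e`. -/
def scaledMgf (p : ℕ) (β h e : ℝ) (N : ℕ) (s : ℝ) : ℝ :=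
  expect p β h N fun x => Real.exp (s * (√N * (x - e)))

theorem likelihood_pos (p : ℕ) (β h : ℝ) {N : ℕ} (x : SpinConfig N) : 0 < likelihood p β h x := by
  rw [likelihood_eq_inv]
  exact inv_pos.2 (invLikelihood_pos p β x h)

theorem scaledMgf_pos (p : ℕ) (β h e : ℝ) (N : ℕ) (s : ℝ) : 0 < scaledMgf p β h e N s :=
  Finset.sum_pos (fun x _ => mul_pos (likelihood_pos p β h x) (Real.exp_pos _))
    Finset.univ_nonempty

/-- Shifting the field by `s/√N` tilts the law by `exp(s√N mag)`, and the centering `e` cancels. It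
is free here so that an extremal maximizer can be inserted later. -/
theorem invLikelihood_eq (p : ℕ) (β h e s : ℝ) {N : ℕ} (hN : N ≠ 0) (x : SpinConfig N) :
    invLikelihood p β x (h + s / √N) = invLikelihood p β x h *
      (Real.exp (-(s * (√N * (mag x - e)))) * scaledMgf p β h e N s) := by
  have hN' : (0 : ℝ) < N := by exact_mod_cast Nat.pos_of_ne_zero hN
  have hs : 0 < √(N : ℝ) := Real.sqrt_pos.2 hN'
  have hsum : ∀ x : SpinConfig N, ∑ i, spin x i = √N * √N * mag x := fun x => by
    rw [mag, Real.mul_self_sqrt hN'.le]; field_simp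
  have hlik : ∀ x' : SpinConfig N, invLikelihood p β x h * likelihood p β h x'
      = Real.exp (exponent p β h x' - exponent p β h x) := by
    intro x'
    have h3 : (2 : ℝ) ^ N * partitionFunction p β h N
        = ∑ x : SpinConfig N, Real.exp (exponent p β h x) := by
      unfold partitionFunction
      field_simp
    have h4 : 0 < ∑ x : SpinConfig N, Real.exp (exponent p β h x) :=
      Finset.sum_pos (fun _ _ => Real.exp_pos _) Finset.univ_nonempty
    rw [likelihood, h3, invLikelihood]
    simp only [Real.exp_sub, ← Finset.sum_div]
    field_simp
  rw [scaledMgf, expect, Finset.mul_sum, Finset.mul_sum]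
  simp only [invLikelihood]
  refine Finset.sum_congr rfl fun x' _ => ?_
  rw [mul_left_comm, ← mul_assoc, ← mul_assoc, mul_assoc (Real.exp _),
    show (∑ x', Real.exp (exponent p β h x' - exponent p β h x)) = invLikelihood p β x h from rfl,
    hlik, ← Real.exp_add, ← Real.exp_add]
  congr 1
  rw [exponent_sub_exponent β _ x x', exponent_sub_exponent β h x x', hsum, hsum]
  field_simp
  ring

/-- The slope of the chord of the cumulant generating function. -/
def chordSlope (p : ℕ) (β h e t t' : ℝ) (N : ℕ) : ℝ :=
  (Real.log (scaledMgf p β h e N t') - Real.log (scaledMgf p β h e N t)) / (t' - t)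

theorem invLikelihood_le_iff (p : ℕ) (β h e t t' : ℝ) {N : ℕ} (hN : N ≠ 0) (x : SpinConfig N) :
    invLikelihood p β x (h + t / √N) ≤ invLikelihood p β x (h + t' / √N) ↔
      (t' - t) * (√N * (mag x - e)) ≤
        Real.log (scaledMgf p β h e N t') - Real.log (scaledMgf p β h e N t) := by
  rw [invLikelihood_eq p β h e t hN, invLikelihood_eq p β h e t' hN,
    mul_le_mul_iff_right₀ (invLikelihood_pos p β x h)]
  rw [← Real.log_le_log_iff (mul_pos (Real.exp_pos _) (scaledMgf_pos _ _ _ _ _ _))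
    (mul_pos (Real.exp_pos _) (scaledMgf_pos _ _ _ _ _ _)),
    Real.log_mul (Real.exp_pos _).ne' (scaledMgf_pos _ _ _ _ _ _).ne',
    Real.log_mul (Real.exp_pos _).ne' (scaledMgf_pos _ _ _ _ _ _).ne', Real.log_exp, Real.log_exp]
  constructor <;> intro h <;> linarith

/-- A convex function does not decrease to the right of a minimizer, so its value at `t` is at most
that at `t'`; in logarithms this is linear in the magnetization. Uniqueness of the minimizer plays
no role. -/
theorem IsMLE.le_chordSlope {p : ℕ} {β : ℝ} {N : ℕ} {hhat : SpinConfig N → ℝ}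
    (hmle : IsMLE p β hhat) (hN : N ≠ 0) {x : SpinConfig N} (hx : mag x ∈ Ioo (-1 : ℝ) 1)
    (h e : ℝ) {t t' : ℝ} (htt' : t < t') (hle : √N * (hhat x - h) ≤ t) :
    √N * (mag x - e) ≤ chordSlope p β h e t t' N := by
  have hN' : (0 : ℝ) < N := by exact_mod_cast Nat.pos_of_ne_zero hN
  have hs : 0 < √(N : ℝ) := Real.sqrt_pos.2 hN'
  have h1 : hhat x ≤ h + t / √N := by
    have : hhat x - h ≤ t / √N := by rw [le_div_iff₀ hs]; linarith
    linarith
  have h2 : h + t / √N ≤ h + t' / √N := by gcongr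
  have h3 := (convexOn_invLikelihood p β x).le_max_of_mem_Icc (mem_univ (hhat x))
    (mem_univ (h + t' / √N)) ⟨h1, h2⟩
  rw [max_eq_right (hmle.invLikelihood_le hN hx _), invLikelihood_le_iff p β h e t t' hN] at h3
  rw [chordSlope, le_div_iff₀ (by linarith)]
  linarith

theorem IsMLE.chordSlope_le {p : ℕ} {β : ℝ} {N : ℕ} {hhat : SpinConfig N → ℝ}
    (hmle : IsMLE p β hhat) (hN : N ≠ 0) {x : SpinConfig N} (hx : mag x ∈ Ioo (-1 : ℝ) 1)
    (h e : ℝ) {t t' : ℝ} (htt' : t' < t) (hlt : t < √N * (hhat x - h)) :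
    chordSlope p β h e t t' N ≤ √N * (mag x - e) := by
  have hN' : (0 : ℝ) < N := by exact_mod_cast Nat.pos_of_ne_zero hN
  have hs : 0 < √(N : ℝ) := Real.sqrt_pos.2 hN'
  have h1 : h + t / √N ≤ hhat x := by
    have : t / √N ≤ hhat x - h := by rw [div_le_iff₀ hs]; linarith
    linarith
  have h2 : h + t' / √N ≤ h + t / √N := by gcongr
  have h3 := (convexOn_invLikelihood p β x).le_max_of_mem_Icc (mem_univ (h + t' / √N))
    (mem_univ (hhat x)) ⟨h2, h1⟩
  rw [max_eq_left (hmle.invLikelihood_le hN hx _), invLikelihood_le_iff p β h e t t' hN] at h3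
  rw [chordSlope, div_le_iff_of_neg (by linarith)]
  linarith

namespace IsPeakSet

variable {p : ℕ} {β h : ℝ} {M : Finset ℝ}

/-- The term `log p_e` of the limiting cumulant generating function cancels, leaving a chord of a
parabola. -/
theorem tendsto_chordSlope (hM : IsPeakSet p β h M) {e t t' : ℝ} (he : e ∈ M) (htt' : t ≠ t')
    (ht : ∀ m ∈ M, m ≠ e → t * (m - e) < 0) (ht' : ∀ m ∈ M, m ≠ e → t' * (m - e) < 0) :
    Tendsto (chordSlope p β h e t t') atTop (𝓝 ((t + t') / (2 * -curv p β e))) := by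
  have hp := hM.peakProb_pos he
  have hlog : ∀ s : ℝ, (∀ m ∈ M, m ≠ e → s * (m - e) < 0) →
      Tendsto (fun N => Real.log (scaledMgf p β h e N s)) atTop
        (𝓝 (Real.log (peakProb p β M e) + s ^ 2 / (2 * -curv p β e))) := by
    intro s hs
    have h1 := (hM.tendsto_expect_exp he hs).log (mul_pos hp (Real.exp_pos _)).ne'
    rwa [Real.log_mul hp.ne' (Real.exp_pos _).ne', Real.log_exp] at h1
  have h2 := ((hlog t' ht').sub (hlog t ht)).div_const (t' - t)
  have hval : (Real.log (peakProb p β M e) + t' ^ 2 / (2 * -curv p β e)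
      - (Real.log (peakProb p β M e) + t ^ 2 / (2 * -curv p β e))) / (t' - t)
      = (t + t') / (2 * -curv p β e) := by
    have h3 : t' - t ≠ 0 := sub_ne_zero.2 htt'.symm
    have h4 : curv p β e ≠ 0 := (hM.curv_neg e he).ne
    field_simp
    ring
  rwa [hval] at h2

theorem mag_mem_Ioo_or {N : ℕ} (hN : N ≠ 0) (x : SpinConfig N) :
    mag x ∈ Ioo (-1 : ℝ) 1 ∨ mag x ∈ ({1, -1} : Set ℝ) := by
  have hcard : (plusSpins x).card ≤ N := by simpa using Finset.card_le_univ (plusSpins x)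
  have := site_mem_Icc hN hcard
  rw [← mag_eq_site hN] at this
  rcases this.1.eq_or_lt with h | h
  · exact Or.inr (Or.inr h.symm)
  · rcases this.2.eq_or_lt with h' | h'
    · exact Or.inr (Or.inl h')
    · exact Or.inl ⟨h, h'⟩

/-- The distribution function of the rescaled estimator converges, on the side of the extremal
maximizer `e`. -/
theorem tendsto_law_real_mle (hM : IsPeakSet p β h M) {hhat : ∀ N, SpinConfig N → ℝ}
    (hmle : ∀ N, IsMLE p β (hhat N)) {e t : ℝ} (he : e ∈ M) (ht0 : t ≠ 0)
    (ht : ∀ m ∈ M, m ≠ e → t * (m - e) < 0) :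
    Tendsto (fun N => (law p β h N).real {x | √N * (hhat N x - h) ≤ t}) atTop
      (𝓝 (limitCDF p β M e (t / -curv p β e))) := by
  -- Points `s` on the same side of `0` as `t` select the same extremal maximizer, so chords near
  -- `t` are admissible.
  have hsign : ∀ s : ℝ, 0 < s * t → ∀ m ∈ M, m ≠ e → s * (m - e) < 0 := by
    intro s hs m hm hne
    have h1 := ht m hm hne
    have h2 : 0 < t ^ 2 := by positivity
    by_contra! h3
    nlinarith [mul_pos_of_neg_of_neg h1 (neg_neg_of_pos hs)]
  have hcont : Continuous fun s => limitCDF p β M e ((t + s) / (2 * -curv p β e)) :=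
    (hM.continuous_limitCDF he).comp (by fun_prop)
  have hval : limitCDF p β M e ((t + t) / (2 * -curv p β e))
      = limitCDF p β M e (t / -curv p β e) := by
    congr 1
    rw [← two_mul, mul_div_mul_left _ _ two_ne_zero]
  have hpos : ∀ᶠ s in 𝓝 t, 0 < s * t :=
    (continuous_id.mul continuous_const).continuousAt.eventually
      (lt_mem_nhds (mul_self_pos.2 ht0))
  have hb := hM.tendsto_expect_boundary
  rw [← hval]
  refine tendsto_order.2 ⟨fun a ha => ?_, fun a ha => ?_⟩
  · obtain ⟨s, ⟨hs1, hs2⟩, hs3⟩ := (((hcont.continuousAt.eventually (lt_mem_nhds ha)).and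
      hpos).filter_mono nhdsWithin_le_nhds |>.and (self_mem_nhdsWithin (s := Iio t))).exists
    -- The vanishing correction makes the inequality strict, as `chordSlope_le` concludes only a
    -- weak one.
    have hu : Tendsto (fun N : ℕ => chordSlope p β h e t s N - 1 / ((N : ℝ) + 1)) atTop
        (𝓝 ((t + s) / (2 * -curv p β e))) := by
      simpa using (hM.tendsto_chordSlope he (ne_of_gt hs3) ht (hsign s hs2)).sub
        tendsto_one_div_add_atTop_nhds_zero_nat
    have h1 := (hM.tendsto_expect_Iic he hu).sub hb
    rw [sub_zero] at h1
    filter_upwards [h1.eventually (lt_mem_nhds hs1), eventually_ne_atTop 0] with N h2 hN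
    refine h2.trans_le ?_
    rw [sub_le_iff_le_add]
    refine expect_le_law_real_add fun x hx => ?_
    rcases mag_mem_Ioo_or hN x with hi | hi
    · left
      by_contra hlt
      have h3 := (hmle N).chordSlope_le hN hi h e hs3 (not_le.1 hlt)
      have h4 : (0 : ℝ) < 1 / ((N : ℝ) + 1) := by positivity
      have h5 : √N * (mag x - e) ≤ chordSlope p β h e t s N - 1 / ((N : ℝ) + 1) := hx
      linarith
    · exact Or.inr hi
  · obtain ⟨s, ⟨hs1, hs2⟩, hs3⟩ := (((hcont.continuousAt.eventually (gt_mem_nhds ha)).and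
      hpos).filter_mono nhdsWithin_le_nhds |>.and (self_mem_nhdsWithin (s := Ioi t))).exists
    have h1 := (hM.tendsto_expect_Iic he
      (hM.tendsto_chordSlope he (ne_of_lt hs3) ht (hsign s hs2))).add hb
    rw [add_zero] at h1
    filter_upwards [h1.eventually (gt_mem_nhds hs1), eventually_ne_atTop 0] with N h2 hN
    refine lt_of_le_of_lt (law_real_le_expect_add fun x hx => ?_) h2
    rcases mag_mem_Ioo_or hN x with hi | hi
    · exact Or.inl ((hmle N).le_chordSlope hN hi h e hs3 hx)
    · exact Or.inr hi

end IsPeakSet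

/-! ### From distribution functions to convergence in law -/

/-- Half-open intervals with nonzero endpoints form a π-system fine enough to determine convergence.
The point `0` is excluded because the limit laws have an atom there. -/
theorem convergesInLaw_of_tendsto_Iic {Ω : ℕ → Type} [∀ N, MeasurableSpace (Ω N)]
    {X : ∀ N, Ω N → ℝ} {P : ∀ N, Measure (Ω N)} [∀ N, IsProbabilityMeasure (P N)] {ν : Measure ℝ}
    [hν : IsProbabilityMeasure ν] (hX : ∀ N, Measurable (X N))
    (h : ∀ t ≠ 0, Tendsto (fun N => (P N).real {x | X N x ≤ t}) atTop (𝓝 (ν.real (Iic t)))) :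
    ConvergesInLaw X P ν := by
  refine ⟨hν, fun N => (hX N).aemeasurable, aemeasurable_id, ?_⟩
  refine (isPiSystem_Ioc_mem {a : ℝ | a ≠ 0} {a : ℝ | a ≠ 0}).tendsto_probabilityMeasure_of_tendsto_of_mem
    ?_ ?_ ?_
  · rintro _ ⟨a, _, b, _, _, rfl⟩
    exact measurableSet_Ioc
  · intro u hu x hx
    obtain ⟨a, b, hxab, hab⟩ := mem_nhds_iff_exists_Ioo_subset.1 (hu.mem_nhds hx)
    have hdense : Dense ({0}ᶜ : Set ℝ) := dense_compl_singleton 0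
    obtain ⟨c, hc, hac, hcx⟩ := hdense.exists_between hxab.1
    obtain ⟨d, hd, hxd, hdb⟩ := hdense.exists_between hxab.2
    exact ⟨Ioc c d, ⟨c, hc, d, hd, hcx.trans hxd, rfl⟩, Ioc_mem_nhds hcx hxd,
      fun y hy => hab ⟨hac.trans hy.1, hy.2.trans_lt hdb⟩⟩
  · rintro _ ⟨a, ha, b, hb, hab, rfl⟩
    have hdiff : ∀ (μ : Measure ℝ) [IsProbabilityMeasure μ],
        μ.real (Ioc a b) = μ.real (Iic b) - μ.real (Iic a) := by
      intro μ _
      rw [← Iic_sdiff_Iic, measureReal_sdiff (Iic_subset_Iic.2 hab.le) measurableSet_Iic]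
    have hmap : ∀ N, IsProbabilityMeasure ((P N).map (X N)) := fun N =>
      Measure.isProbabilityMeasure_map (hX N).aemeasurable
    have hlim : Tendsto (fun N => ((P N).map (X N)).real (Ioc a b)) atTop (𝓝 (ν.real (Ioc a b))) := by
      rw [hdiff ν]
      refine ((h b hb).sub (h a ha)).congr fun N => ?_
      rw [hdiff, map_measureReal_apply (hX N) measurableSet_Iic,
        map_measureReal_apply (hX N) measurableSet_Iic]
      rfl
    rw [← NNReal.tendsto_coe]
    simp only [Measure.map_id]
    exact hlim

/-! ### Half-normal distributions -/

instance (v : ℝ) : IsProbabilityMeasure (normal v) := by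
  unfold normal; infer_instance

instance (v : ℝ) : IsProbabilityMeasure (halfNormalPos v) :=
  Measure.isProbabilityMeasure_map (by fun_prop)

instance (v : ℝ) : IsProbabilityMeasure (halfNormalNeg v) :=
  Measure.isProbabilityMeasure_map (by fun_prop)

theorem normal_real_Ici_neg (v t : ℝ) : (normal v).real (Ici (-t)) = (normal v).real (Iic t) := by
  have h : (normal v).map (fun x => -x) = normal v := by
    unfold normal
    rw [gaussianReal_map_neg, neg_zero]
  conv_rhs => rw [← h]
  rw [map_measureReal_apply measurable_neg measurableSet_Iic]
  congr 1
  ext x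
  simp only [mem_Ici, mem_preimage, mem_Iic]
  constructor <;> intro h <;> linarith

theorem normal_real_Iio (v t : ℝ) :
    (normal v).real (Iio (-t)) = 1 - (normal v).real (Iic t) := by
  rw [← normal_real_Ici_neg, ← compl_Ici, probReal_compl_eq_one_sub measurableSet_Ici]

theorem halfNormalPos_real_Iic_of_neg (v : ℝ) {t : ℝ} (ht : t < 0) :
    (halfNormalPos v).real (Iic t) = 0 := by
  rw [halfNormalPos, map_measureReal_apply (by fun_prop) measurableSet_Iic]
  have : (fun z : ℝ => |z|) ⁻¹' Iic t = ∅ := by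
    ext z
    simp only [mem_preimage, mem_Iic, mem_empty_iff_false, iff_false, not_le]
    linarith [abs_nonneg z]
  rw [this, measureReal_empty]

theorem halfNormalPos_real_Iic_of_pos (v : ℝ) {t : ℝ} (ht : 0 < t) :
    (halfNormalPos v).real (Iic t) = 2 * (normal v).real (Iic t) - 1 := by
  rw [halfNormalPos, map_measureReal_apply (by fun_prop) measurableSet_Iic]
  have : (fun z : ℝ => |z|) ⁻¹' Iic t = Iic t \ Iio (-t) := by
    ext z
    simp only [mem_preimage, mem_Iic, Set.mem_sdiff, mem_Iio, not_lt, abs_le]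
    tauto
  have hsub : Iio (-t) ⊆ Iic t := Iio_subset_Iic (by linarith)
  rw [this, measureReal_sdiff hsub measurableSet_Iio, normal_real_Iio]
  ring

theorem halfNormalNeg_real_Iic_of_pos (v : ℝ) {t : ℝ} (ht : 0 < t) :
    (halfNormalNeg v).real (Iic t) = 1 := by
  rw [halfNormalNeg, map_measureReal_apply (by fun_prop) measurableSet_Iic]
  have : (fun z : ℝ => -|z|) ⁻¹' Iic t = univ := by
    ext z
    simp only [mem_preimage, mem_Iic, mem_univ, iff_true]
    linarith [abs_nonneg z]
  rw [this, probReal_univ]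

theorem halfNormalNeg_real_Iic_of_neg (v : ℝ) {t : ℝ} (ht : t < 0) :
    (halfNormalNeg v).real (Iic t) = 2 * (normal v).real (Iic t) := by
  rw [halfNormalNeg, map_measureReal_apply (by fun_prop) measurableSet_Iic]
  have : (fun z : ℝ => -|z|) ⁻¹' Iic t = Iic t ∪ Ici (-t) := by
    ext z
    simp only [mem_preimage, mem_Iic, mem_union, mem_Ici]
    rw [neg_le, le_abs, or_comm]
    exact or_congr (by constructor <;> intro h <;> linarith) Iff.rfl
  rw [this, measureReal_union ?_ measurableSet_Ici, normal_real_Ici_neg]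
  · ring
  · rw [Set.disjoint_left]
    intro z hz hz'
    simp only [mem_Iic, mem_Ici] at hz hz'
    linarith

theorem dirac_real_Iic_of_neg {t : ℝ} (ht : t < 0) :
    (Measure.dirac (0 : ℝ)).real (Iic t) = 0 := by
  simp [Measure.real, ht]

theorem dirac_real_Iic_of_pos {t : ℝ} (ht : 0 < t) :
    (Measure.dirac (0 : ℝ)).real (Iic t) = 1 := by
  simp [Measure.real, ht.le]

/-- Division by `-H''(e)` turns variance `-H''(e)` into its inverse: the magnetization and the
estimator have reciprocal variances. -/
theorem peakLaw_real_Iic {p : ℕ} {β e : ℝ} (hc : curv p β e < 0) (t : ℝ) :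
    (peakLaw p β e).real (Iic (t / -curv p β e)) = (normal (-curv p β e)).real (Iic t) := by
  set l := -curv p β e with hl
  have hl0 : 0 < l := by linarith
  have h : peakLaw p β e = (normal l).map (l⁻¹ * ·) := by
    rw [normal, gaussianReal_map_const_mul, mul_zero, peakLaw, ← hl]
    congr 1
    ext
    rw [NNReal.coe_mul, Real.coe_toNNReal _ hl0.le, Real.coe_toNNReal _ (by positivity)]
    simp only [NNReal.coe_mk]
    field_simp
  rw [h, map_measureReal_apply (by fun_prop) measurableSet_Iic]
  congr 1
  ext z
  simp only [mem_preimage, mem_Iic]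
  rw [inv_mul_eq_div, div_le_div_iff_of_pos_right hl0]

/-! ### Limit laws -/

theorem isProbabilityMeasure_add_smul {μ₁ μ₂ : Measure ℝ} [IsProbabilityMeasure μ₁]
    [IsProbabilityMeasure μ₂] {a b : ℝ} (ha : 0 ≤ a) (hb : 0 ≤ b) (hab : a + b = 1) :
    IsProbabilityMeasure (ENNReal.ofReal a • μ₁ + ENNReal.ofReal b • μ₂) := by
  constructor
  simp only [Measure.add_apply, Measure.smul_apply, measure_univ, smul_eq_mul, mul_one]
  rw [← ENNReal.ofReal_add ha hb, hab, ENNReal.ofReal_one]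

theorem isProbabilityMeasure_add_smul₃ {μ₁ μ₂ μ₃ : Measure ℝ} [IsProbabilityMeasure μ₁]
    [IsProbabilityMeasure μ₂] [IsProbabilityMeasure μ₃] {a b c : ℝ} (ha : 0 ≤ a) (hb : 0 ≤ b)
    (hc : 0 ≤ c) (habc : a + b + c = 1) :
    IsProbabilityMeasure
      (ENNReal.ofReal a • μ₁ + ENNReal.ofReal b • μ₂ + ENNReal.ofReal c • μ₃) := by
  constructor
  simp only [Measure.add_apply, Measure.smul_apply, measure_univ, smul_eq_mul, mul_one]
  rw [← ENNReal.ofReal_add ha hb, ← ENNReal.ofReal_add (by positivity) hc, habc, ENNReal.ofReal_one]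

theorem ofReal_smul_real (μ : Measure ℝ) {a : ℝ} (ha : 0 ≤ a) (S : Set ℝ) :
    (ENNReal.ofReal a • μ).real S = a * μ.real S := by
  rw [measureReal_ennreal_smul_apply, ENNReal.toReal_ofReal ha]

theorem add_smul_real {μ₁ μ₂ : Measure ℝ} [IsProbabilityMeasure μ₁]
    [IsProbabilityMeasure μ₂] {a b : ℝ} (ha : 0 ≤ a) (hb : 0 ≤ b) (S : Set ℝ) :
    (ENNReal.ofReal a • μ₁ + ENNReal.ofReal b • μ₂).real S = a * μ₁.real S + b * μ₂.real S := by
  have h₁ : IsFiniteMeasure (ENNReal.ofReal a • μ₁) := μ₁.smul_finite ENNReal.ofReal_ne_top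
  have h₂ : IsFiniteMeasure (ENNReal.ofReal b • μ₂) := μ₂.smul_finite ENNReal.ofReal_ne_top
  rw [measureReal_add_apply, ofReal_smul_real _ ha, ofReal_smul_real _ hb]

theorem add_smul_real₃ {μ₁ μ₂ μ₃ : Measure ℝ} [IsProbabilityMeasure μ₁]
    [IsProbabilityMeasure μ₂] [IsProbabilityMeasure μ₃] {a b c : ℝ} (ha : 0 ≤ a) (hb : 0 ≤ b)
    (hc : 0 ≤ c) (S : Set ℝ) :
    (ENNReal.ofReal a • μ₁ + ENNReal.ofReal b • μ₂ + ENNReal.ofReal c • μ₃).real S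
      = a * μ₁.real S + b * μ₂.real S + c * μ₃.real S := by
  have h₁ : IsFiniteMeasure (ENNReal.ofReal a • μ₁) := μ₁.smul_finite ENNReal.ofReal_ne_top
  have h₂ : IsFiniteMeasure (ENNReal.ofReal b • μ₂) := μ₂.smul_finite ENNReal.ofReal_ne_top
  have h₃ : IsFiniteMeasure (ENNReal.ofReal c • μ₃) := μ₃.smul_finite ENNReal.ofReal_ne_top
  rw [measureReal_add_apply, add_smul_real ha hb, ofReal_smul_real _ hc]

namespace IsPeakSet

variable {p : ℕ} {β h : ℝ} {M : Finset ℝ}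

theorem H''_eq (hM : IsPeakSet p β h M) {m : ℝ} (hm : m ∈ M) : H'' p β h m = curv p β m :=
  H''_eq_curv p β h (hM.mem_Ioo hm)

theorem weight_eq (hM : IsPeakSet p β h M) {m : ℝ} (hm : m ∈ M) :
    weight p β h m = peakProb p β M m := by
  rw [weight, hM.H''_eq hm, ← hM.coe_eq, finsum_mem_coe_finset, peakProb, peakWeight]
  congr 1
  exact Finset.sum_congr rfl fun i hi => by rw [hM.H''_eq hi, peakWeight]

theorem sum_peakProb (hM : IsPeakSet p β h M) : ∑ m ∈ M, peakProb p β M m = 1 := by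
  simp only [peakProb, ← Finset.sum_div]
  exact div_self hM.sum_peakWeight_pos.ne'

/-- Negative `t` is read off at the smallest maximizer `a`, positive `t` at the largest `b`. Any
other maximizer affects the limit only through the normalization of the weights and the size of the
atom at `0`. -/
theorem convergesInLaw_mle (hM : IsPeakSet p β h M) {hhat : ∀ N, SpinConfig N → ℝ}
    (hmle : ∀ N, IsMLE p β (hhat N)) {a b : ℝ} (ha : a ∈ M) (hb : b ∈ M)
    (hmin : ∀ m ∈ M, a ≤ m) (hmax : ∀ m ∈ M, m ≤ b) {ν : Measure ℝ} [IsProbabilityMeasure ν]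
    (hneg : ∀ t < 0, ν.real (Iic t)
      = peakProb p β M a * (normal (-curv p β a)).real (Iic t))
    (hpos : ∀ t, 0 < t → ν.real (Iic t) = (1 - peakProb p β M b)
      + peakProb p β M b * (normal (-curv p β b)).real (Iic t)) :
    ConvergesInLaw (fun N x => √N * (hhat N x - h)) (law p β h) ν := by
  refine convergesInLaw_of_tendsto_Iic (fun N => measurable_from_top) fun t ht => ?_
  rcases lt_or_gt_of_ne ht with h0 | h0
  · have := hM.tendsto_law_real_mle hmle ha ht fun m hm hne =>
      mul_neg_of_neg_of_pos h0 (sub_pos.2 (lt_of_le_of_ne (hmin m hm) hne.symm))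
    rw [limitCDF, peakLaw_real_Iic (hM.curv_neg a ha),
      Finset.filter_false_of_mem fun m hm => not_lt.2 (hmin m hm), Finset.sum_empty, zero_add] at this
    rwa [hneg t h0]
  · have := hM.tendsto_law_real_mle hmle hb ht fun m hm hne =>
      mul_neg_of_pos_of_neg h0 (sub_neg.2 (lt_of_le_of_ne (hmax m hm) hne))
    have hsum : ∑ m ∈ M with m < b, peakProb p β M m = 1 - peakProb p β M b := by
      have hfilter : (M.filter fun m => m < b) = M.erase b := by
        ext m
        simp only [Finset.mem_filter, Finset.mem_erase]
        exact ⟨fun H => ⟨H.2.ne, H.1⟩, fun H => ⟨H.2, lt_of_le_of_ne (hmax m H.2) H.1⟩⟩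
      rw [hfilter, ← hM.sum_peakProb, ← Finset.sum_erase_add M _ hb, add_sub_cancel_right]
    rw [limitCDF, peakLaw_real_Iic (hM.curv_neg b hb), hsum] at this
    rwa [hpos t h0]

theorem peakProb_le_one (hM : IsPeakSet p β h M) {m : ℝ} (hm : m ∈ M) : peakProb p β M m ≤ 1 := by
  rw [← hM.sum_peakProb]
  exact Finset.single_le_sum (f := peakProb p β M) (fun i hi => (hM.peakProb_pos hi).le) hm

end IsPeakSet

/-- Two maximizers: the limit is a mixture of two half-normal laws and a point mass. -/
theorem convergesInLaw_of_pair {p : ℕ} (hp : 1 ≤ p) {β h m₁ m₂ : ℝ} (hlt : m₁ < m₂)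
    (hmax : maximizers p β h = {m₁, m₂}) (c₁ : curv p β m₁ < 0) (c₂ : curv p β m₂ < 0)
    {hhat : ∀ N, SpinConfig N → ℝ} (hmle : ∀ N, IsMLE p β (hhat N)) :
    ConvergesInLaw (fun N x => √N * (hhat N x - h)) (law p β h)
      (ENNReal.ofReal (weight p β h m₁ / 2) • halfNormalNeg (-H'' p β h m₁) +
        ENNReal.ofReal ((1 - weight p β h m₁) / 2) • halfNormalPos (-H'' p β h m₂) +
        ENNReal.ofReal (1 / 2) • Measure.dirac 0) := by
  have hM : IsPeakSet p β h {m₁, m₂} := ⟨hp, by simp [hmax], by simp [c₁, c₂]⟩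
  have h₁ : m₁ ∈ ({m₁, m₂} : Finset ℝ) := by simp
  have h₂ : m₂ ∈ ({m₁, m₂} : Finset ℝ) := by simp
  rw [hM.weight_eq h₁, hM.H''_eq h₁, hM.H''_eq h₂]
  set q := peakProb p β {m₁, m₂} m₁ with hq
  have hq0 : 0 ≤ q / 2 := by linarith [hM.peakProb_pos h₁]
  have hq1 : 0 ≤ (1 - q) / 2 := by linarith [hM.peakProb_le_one h₁]
  have hq2 : peakProb p β {m₁, m₂} m₂ = 1 - q := by
    rw [← hM.sum_peakProb, Finset.sum_pair hlt.ne, hq]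
    ring
  have hprob := isProbabilityMeasure_add_smul₃ (μ₁ := halfNormalNeg (-curv p β m₁))
    (μ₂ := halfNormalPos (-curv p β m₂)) (μ₃ := Measure.dirac 0) hq0 hq1
    (by norm_num : (0 : ℝ) ≤ 1 / 2) (by ring)
  refine hM.convergesInLaw_mle hmle h₁ h₂ (by simp [hlt.le]) (by simp [hlt.le])
    (fun t ht => ?_) fun t ht => ?_
  · rw [add_smul_real₃ hq0 hq1 (by norm_num), halfNormalNeg_real_Iic_of_neg _ ht,
      halfNormalPos_real_Iic_of_neg _ ht, dirac_real_Iic_of_neg ht]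
    ring
  · rw [add_smul_real₃ hq0 hq1 (by norm_num), halfNormalNeg_real_Iic_of_pos _ ht,
      halfNormalPos_real_Iic_of_pos _ ht, dirac_real_Iic_of_pos ht, hq2]
    ring

/-- Extremal maximizers `-m` and `m` of equal weight: the limit is a mixture of a normal law and a
point mass. -/
theorem IsPeakSet.convergesInLaw_of_symmetric {p : ℕ} (he : Even p) {β h m : ℝ} {M : Finset ℝ}
    (hM : IsPeakSet p β h M) (h₁ : -m ∈ M) (h₂ : m ∈ M) (hsub : ∀ x ∈ M, -m ≤ x ∧ x ≤ m)
    {hhat : ∀ N, SpinConfig N → ℝ} (hmle : ∀ N, IsMLE p β (hhat N)) :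
    ConvergesInLaw (fun N x => √N * (hhat N x - h)) (law p β h)
      (ENNReal.ofReal (weight p β h (-m)) • normal (-H'' p β h m) +
        ENNReal.ofReal (1 - weight p β h (-m)) • Measure.dirac 0) := by
  rw [hM.weight_eq h₁, hM.H''_eq h₂]
  have hq : peakProb p β M m = peakProb p β M (-m) := by
    simp only [peakProb, peakWeight, neg_sq, curv_neg_arg he]
  set q := peakProb p β M (-m)
  have hq0 : 0 ≤ q := (hM.peakProb_pos h₁).le
  have hq1 : 0 ≤ 1 - q := by linarith [hM.peakProb_le_one h₁]
  have hprob := isProbabilityMeasure_add_smul (μ₁ := normal (-curv p β m))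
    (μ₂ := Measure.dirac 0) hq0 hq1 (by ring)
  refine hM.convergesInLaw_mle hmle h₁ h₂ (fun x hx => (hsub x hx).1) (fun x hx => (hsub x hx).2)
    (fun t ht => ?_) fun t ht => ?_
  · rw [add_smul_real hq0 hq1, dirac_real_Iic_of_neg ht, curv_neg_arg he]
    ring
  · rw [add_smul_real hq0 hq1, dirac_real_Iic_of_pos ht, hq]
    ring

theorem ncard_symmetric_triple {m : ℝ} (hm : 0 < m) : ({-m, 0, m} : Set ℝ).ncard = 3 := by
  rw [Set.ncard_eq_three]
  exact ⟨-m, 0, m, by linarith, by linarith, by linarith, rfl⟩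

end CurieWeiss
end

/-! ### The limit theorem, by the parity of `p` and the vanishing of `h` -/

theorem theorem2p4 (p : ℕ) (hp : 3 ≤ p) (β h : ℝ) (hcrit : CurieWeiss.IsCritical p β h)
    (hhat : ∀ N : ℕ, CurieWeiss.SpinConfig N → ℝ)
    (hmle : ∀ N : ℕ, CurieWeiss.IsMLE p β (hhat N)) :
    -- standing facts: two or three maximizers, all interior and nondegenerate
    ((CurieWeiss.maximizers p β h).ncard = 2 ∨ (CurieWeiss.maximizers p β h).ncard = 3) ∧
    (∀ m ∈ CurieWeiss.maximizers p β h,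
      m ∈ Set.Ioo (-1 : ℝ) 1 ∧ CurieWeiss.H'' p β h m < 0) ∧
    -- `p` odd
    (Odd p → ∃ m₁ m₂ : ℝ, m₁ < m₂ ∧ m₁ ≠ -m₂ ∧ CurieWeiss.maximizers p β h = {m₁, m₂} ∧
      CurieWeiss.ConvergesInLaw
        (fun N x => Real.sqrt N * (hhat N x - h))
        (CurieWeiss.law p β h)
        (ENNReal.ofReal (CurieWeiss.weight p β h m₁ / 2) •
            CurieWeiss.halfNormalNeg (-CurieWeiss.H'' p β h m₁) +
          ENNReal.ofReal ((1 - CurieWeiss.weight p β h m₁) / 2) •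
            CurieWeiss.halfNormalPos (-CurieWeiss.H'' p β h m₂) +
          ENNReal.ofReal (1 / 2) • MeasureTheory.Measure.dirac 0)) ∧
    -- `p` even
    (Even p →
      (h ≠ 0 → ∃ m₁ m₂ : ℝ, m₁ < m₂ ∧ m₁ ≠ -m₂ ∧ CurieWeiss.maximizers p β h = {m₁, m₂} ∧
        CurieWeiss.ConvergesInLaw
          (fun N x => Real.sqrt N * (hhat N x - h))
          (CurieWeiss.law p β h)
          (ENNReal.ofReal (CurieWeiss.weight p β h m₁ / 2) •
              CurieWeiss.halfNormalNeg (-CurieWeiss.H'' p β h m₁) +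
            ENNReal.ofReal ((1 - CurieWeiss.weight p β h m₁) / 2) •
              CurieWeiss.halfNormalPos (-CurieWeiss.H'' p β h m₂) +
            ENNReal.ofReal (1 / 2) • MeasureTheory.Measure.dirac 0)) ∧
      (h = 0 → CurieWeiss.betaTilde p < β →
        ∃ m : ℝ, 0 < m ∧ CurieWeiss.maximizers p β h = {-m, m} ∧
          CurieWeiss.ConvergesInLaw
            (fun N x => Real.sqrt N * hhat N x)
            (CurieWeiss.law p β h)
            (ENNReal.ofReal (1 / 2) • CurieWeiss.normal (-CurieWeiss.H'' p β h m) +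
              ENNReal.ofReal (1 / 2) • MeasureTheory.Measure.dirac 0)) ∧
      (h = 0 → β = CurieWeiss.betaTilde p →
        ∃ m : ℝ, 0 < m ∧ CurieWeiss.maximizers p β h = {-m, 0, m} ∧
          CurieWeiss.ConvergesInLaw
            (fun N x => Real.sqrt N * hhat N x)
            (CurieWeiss.law p β h)
            (ENNReal.ofReal (CurieWeiss.weight p β h (-m)) •
                CurieWeiss.normal (-CurieWeiss.H'' p β h (-m)) +
              ENNReal.ofReal (1 - CurieWeiss.weight p β h (-m)) •
                MeasureTheory.Measure.dirac 0))) := by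
  have hp1 : 1 ≤ p := by omega
  have hnt := hcrit.2
  have hfacts : ∀ M : Finset ℝ, CurieWeiss.IsPeakSet p β h M →
      ∀ m ∈ CurieWeiss.maximizers p β h, m ∈ Set.Ioo (-1 : ℝ) 1 ∧ CurieWeiss.H'' p β h m < 0 := by
    intro M hM m hm
    rw [← hM.coe_eq] at hm
    exact ⟨hM.mem_Ioo hm, by rw [hM.H''_eq hm]; exact hM.curv_neg m hm⟩
  have hpair : ∀ m₁ m₂ : ℝ, m₁ < m₂ → CurieWeiss.maximizers p β h = {m₁, m₂} →
      CurieWeiss.curv p β m₁ < 0 → CurieWeiss.curv p β m₂ < 0 →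
      (CurieWeiss.maximizers p β h).ncard = 2 ∧ CurieWeiss.IsPeakSet p β h {m₁, m₂} := by
    intro m₁ m₂ hlt hM c₁ c₂
    exact ⟨by rw [hM, Set.ncard_pair hlt.ne], hp1, by simp [hM], by simp [c₁, c₂]⟩
  rcases Nat.even_or_odd p with he | ho
  · have hno : ¬ Odd p := Nat.not_odd_iff_even.2 he
    by_cases hh : h = 0
    · subst hh
      obtain ⟨m, hm0, hmneg, hmmem, hsub, hc⟩ := CurieWeiss.maximizers_of_even_of_zero hp he hnt
      have hc' : CurieWeiss.curv p β (-m) < 0 := by rwa [CurieWeiss.curv_neg_arg he]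
      -- Membership of the origin replaces the comparison of `β` with the threshold: if it holds,
      -- `β` cannot exceed the threshold, and if it fails, `β` cannot equal it.
      by_cases h0 : (0 : ℝ) ∈ CurieWeiss.maximizers p β 0
      · have hM : CurieWeiss.maximizers p β 0 = {-m, 0, m} := by
          refine Set.Subset.antisymm hsub ?_
          rintro x (rfl | rfl | rfl) <;> assumption
        have hpk : CurieWeiss.IsPeakSet p β 0 {-m, 0, m} :=
          ⟨hp1, by simp [hM], by simp [hc, hc', CurieWeiss.curv_zero_neg hp]⟩
        refine ⟨Or.inr (by rw [hM, CurieWeiss.ncard_symmetric_triple hm0]), hfacts _ hpk,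
          fun h => (hno h).elim, fun _ => ⟨fun h => (h rfl).elim, fun _ hβ =>
            (CurieWeiss.zero_notMem_maximizers_of_betaTilde_lt hp hβ h0).elim,
            fun _ _ => ⟨m, hm0, hM, ?_⟩⟩⟩
        have hconv := hpk.convergesInLaw_of_symmetric (m := m) he (by simp) (by simp)
          (by simp only [Finset.mem_insert, Finset.mem_singleton]
              rintro x (rfl | rfl | rfl) <;> constructor <;> linarith) hmle
        rw [hpk.H''_eq (m := m) (by simp)] at hconv
        rw [hpk.H''_eq (m := -m) (by simp), CurieWeiss.curv_neg_arg he]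
        simpa only [sub_zero] using hconv
      · have hM : CurieWeiss.maximizers p β 0 = {-m, m} := by
          refine Set.Subset.antisymm (fun x hx => ?_) ?_
          · rcases hsub hx with rfl | rfl | rfl
            · exact Or.inl rfl
            · exact (h0 hx).elim
            · exact Or.inr rfl
          · rintro x (rfl | rfl) <;> assumption
        obtain ⟨hcard, hpk⟩ := hpair _ _ (by linarith) hM hc' hc
        refine ⟨Or.inl hcard, hfacts _ hpk,
          fun h => (hno h).elim, fun _ => ⟨fun h => (h rfl).elim, fun _ _ => ⟨m, hm0, hM, ?_⟩,
            fun _ hβ => (h0 (CurieWeiss.zero_mem_maximizers_of_eq_betaTilde hp hβ)).elim⟩⟩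
        have hconv := hpk.convergesInLaw_of_symmetric (m := m) he (by simp) (by simp)
          (by simp only [Finset.mem_insert, Finset.mem_singleton]
              rintro x (rfl | rfl) <;> constructor <;> linarith) hmle
        -- The two weights are equal by symmetry and sum to `1`.
        have hw : CurieWeiss.weight p β 0 (-m) = 1 / 2 := by
          have hsum := hpk.sum_peakProb
          have heq : CurieWeiss.peakProb p β {-m, m} m = CurieWeiss.peakProb p β {-m, m} (-m) := by
            simp only [CurieWeiss.peakProb, CurieWeiss.peakWeight, neg_sq,
              CurieWeiss.curv_neg_arg he]
          rw [Finset.sum_pair (by linarith), heq] at hsum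
          rw [hpk.weight_eq (by simp)]
          linarith
        rw [hw, show (1 - 1 / 2 : ℝ) = 1 / 2 by norm_num] at hconv
        simpa only [sub_zero] using hconv
    · obtain ⟨m₁, m₂, hlt, hne, hM, c₁, c₂⟩ := CurieWeiss.maximizers_of_even_of_ne hp he hh hnt
      obtain ⟨hcard, hpk⟩ := hpair m₁ m₂ hlt hM c₁ c₂
      exact ⟨Or.inl hcard, hfacts _ hpk, fun h => (hno h).elim, fun _ => ⟨fun _ =>
        ⟨m₁, m₂, hlt, hne, hM, CurieWeiss.convergesInLaw_of_pair hp1 hlt hM c₁ c₂ hmle⟩,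
        fun h => (hh h).elim, fun h => (hh h).elim⟩⟩
  · obtain ⟨m₁, m₂, hlt, hne, hM, c₁, c₂⟩ := CurieWeiss.maximizers_of_odd hp ho hcrit
    obtain ⟨hcard, hpk⟩ := hpair m₁ m₂ hlt hM c₁ c₂
    exact ⟨Or.inl hcard, hfacts _ hpk, fun _ => ⟨m₁, m₂, hlt, hne, hM,
      CurieWeiss.convergesInLaw_of_pair hp1 hlt hM c₁ c₂ hmle⟩,
      fun h => (Nat.not_even_iff_odd.2 ho h).elim⟩
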